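/- Let $(\Xi_n)_{n\ge 1}$ be a sequence of independent random $3\times 3$ real matrices with mutually independent entries, each uniformly distributed on $[-1,1]$. For every $0<\varepsilon<1$ there exists $c_3(\varepsilon)>0$, depending only on $\varepsilon$, such that for every sequence $(A_n)_{n\ge 1}$ of real $3\times 3$ matrices, each of Euclidean operator norm at most $1$, the products $$A^{(n)}_\varepsilon=(A_n+\varepsilon\,\Xi_n)(A_{n-1}+\varepsilon\,\Xi_{n-1})\cdots(A_1+\varepsilon\,\Xi_1)$$ have the following property. For $j=1$ and for $j=2$, the random variable $$\liminf_{n\to\infty}\frac1n\log\frac{s_j(A^{(n)}_\varepsilon)}{s_{j+1}(A^{(n)}_\varepsilon)},$$ where $s_1(M)\ge s_2(M)\ge s_3(M)$ denote the singular values of $M$, is almost surely equal to a (finite) constant, and this constant is at least $c_3(\varepsilon)$. Moreover, $c_3(\varepsilon)>\exp(-1/\varepsilon^{867})$ for all sufficiently small $\varepsilon>0$. -/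

import Mathlib

open MeasureTheory ProbabilityTheory Filter Topology

/-- `Ξ` is the noise: a sequence of independent random `d × d` matrices with independent entries,
each uniformly distributed on `[-1, 1]`.  All the entries `Ξ n ω a b`, over all `n`, `a`, `b`
together, form one mutually independent family. -/
structure IsUniformNoise {Ω : Type*} [MeasurableSpace Ω] (μ : Measure Ω) {d : ℕ}
    (Ξ : ℕ → Ω → Matrix (Fin d) (Fin d) ℝ) : Prop where
  measurable_entry : ∀ (n : ℕ) (a b : Fin d), Measurable (fun ω => Ξ n ω a b)
  uniform_entry : ∀ (n : ℕ) (a b : Fin d),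
    pdf.IsUniform (fun ω => Ξ n ω a b) (Set.Icc (-1 : ℝ) 1) μ volume
  independent_entries :
    iIndepFun (fun (p : ℕ × Fin d × Fin d) (ω : Ω) => Ξ p.1 ω p.2.1 p.2.2) μ

/-- The product `(A_n + ε X_n) ⋯ (A_1 + ε X_1)` of the first `n` perturbed matrices.
The sequences are indexed from `0`, so that `A_i`, `X_i` are `A (i - 1)`, `X (i - 1)`. -/
def perturbedProduct {d : ℕ} (ε : ℝ) (A X : ℕ → Matrix (Fin d) (Fin d) ℝ) :
    ℕ → Matrix (Fin d) (Fin d) ℝ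
  | 0 => 1
  | n + 1 => (A n + ε • X n) * perturbedProduct ε A X n

/-- The singular values of a real square matrix in decreasing order, with multiplicity, indexed
from `0`: `matrixSingularValue M j` is the `(j + 1)`-st largest one. -/
noncomputable def matrixSingularValue {d : ℕ} (M : Matrix (Fin d) (Fin d) ℝ) (j : ℕ) : ℝ :=
  (Matrix.toEuclideanLin M).singularValues j

/-- The lower exponential growth rate, as an extended real number, of the ratio of the
`(j + 1)`-st to the `(j + 2)`-nd singular value along a sequence of matrices. -/
noncomputable def gapGrowthRate {d : ℕ} (P : ℕ → Matrix (Fin d) (Fin d) ℝ) (j : ℕ) : EReal :=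
  liminf (fun n : ℕ =>
    (((1 / (n : ℝ)) *
      Real.log (matrixSingularValue (P n) j / matrixSingularValue (P n) (j + 1)) : ℝ) : EReal))
    atTop

/-!
The ratio `s₂ / s₁` of a matrix `M` is comparable with `√(areaRatio M)`, the square root of
`frobSq (cofactorMatrix M) / frobSq M ^ 2`, and `s₃ / s₂` with the same expression in
`cofactorMatrix M` (`gapRatio_bounds`): both compare the areas of the images of the coordinate planes
with the squared lengths in these images. As `cofactorMatrix` is multiplicative, the two gaps are
treated together, for an action `c` which is the identity or `cofactorMatrix` (`ShearsFrames`).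

**The gap grows in mean.** Attach to a pair `M` of vectors in space the indicator function of the unit
disc of the plane they span, read in the coordinates `ℝ²` given by `M` and normalised in area. The
more eccentric the parallelogram of `M`, the more elongated this ellipse of fixed area. Its expectation
under the random product is a function on `ℝ²`, and a decay of the `L²` norm of the latter
bounds the expected eccentricity (`sq_lintegral_eccentricity_le`). One random step contracts the
`L²` norm by a definite factor, whatever the matrix `A n` (`FrameFunction.averaged`): multiplying
`A n + ε X` on the right by a matrix `1 + t E` with `t` of order `ε` amounts to a volume preserving
change of the noise `X`, so that a fixed proportion of the randomness can be used to apply, with equal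
probabilities, the identity or one of two transverse shears of size `1 / N ≈ ε / 9` to the plane before
the step. Averaging over these three maps multiplies squared `L²` norms by at most `1 - const / N²`
(`lintegral_sq_average_shears_le`), by a ping-pong argument for the shears of size one
(`eLpNorm_sq_le_of_unit_shears`). Hence the mean of `√(areaRatio (c P_n))` is at most `6 σ ^ n` with
`1 - σ²` of order `ε²` (`lintegral_sqrt_frobSq_div_le`), and by Borel-Cantelli the growth rate of
the gap is almost surely at least `ε² / 10 ^ 8` (`IsUniformNoise.ae_le_gapRate`).

**The rate is finite.** The gap of `P_n` is polynomially bounded in `‖P_n‖` and `1 / |det P_n|`. As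
`|det (A n + ε Ξ n)| ^ (-1/2)` has bounded mean (`exists_lintegral_det_rpow_le`), Fatou's lemma bounds
the lower limit of the averages of these variables (`IsUniformNoise.ae_gapRate_lt_top`).

**The rate is constant.** Multiplying by a fixed invertible matrix on the right changes the gap by a
bounded factor, so the growth rate is a tail function of independent variables, and Kolmogorov's
zero-one law applies (`IsUniformNoise.exists_ae_gapRate_eq`).
-/

open scoped ENNReal Matrix

/-! ### The spectral gap of small shears of the plane -/

lemma measurePreserving_mulVec {n : Type*} [Fintype n] [DecidableEq n] (g : Matrix n n ℝ)
    (hg : |g.det| = 1) : MeasurePreserving (fun x : n → ℝ => g *ᵥ x) volume volume := by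
  have hdet : g.det ≠ 0 := by intro h; simp [h] at hg
  refine ⟨(Continuous.matrix_mulVec continuous_const continuous_id).measurable, ?_⟩
  have h := Real.map_matrix_volume_pi_eq_smul_volume_pi hdet
  rw [abs_inv, hg] at h
  rw [inv_one, ENNReal.ofReal_one, one_smul] at h
  exact h

section PingPong

variable {k : (Fin 2 → ℝ) → ℝ}

/-- Moving a function by a one-parameter group of volume preserving maps for `n` time steps changes
it by at most `n` times the change after one step, because each step is an isometry of `L²`. -/
lemma eLpNorm_comp_pow_sub_le {g : ℝ → Matrix (Fin 2) (Fin 2) ℝ} (hadd : ∀ s t, g (s + t) = g s * g t)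
    (h0 : g 0 = 1) (hdet : ∀ s, |(g s).det| = 1) (hk : Measurable k) (t : ℝ) (n : ℕ) :
    eLpNorm (fun x => k (g (n * t) *ᵥ x) - k x) 2 volume
      ≤ n * eLpNorm (fun x => k (g t *ᵥ x) - k x) 2 volume := by
  have hm : ∀ s, Measurable fun x => k (g s *ᵥ x) - k x := fun s =>
    (hk.comp (measurePreserving_mulVec _ (hdet s)).measurable).sub hk
  induction n with
  | zero => simp [h0]
  | succ n ih =>
    have hsplit : (fun x => k (g ((n + 1 : ℕ) * t) *ᵥ x) - k x)
        = (fun x => k (g (n * t) *ᵥ x) - k x) ∘ (fun x => g t *ᵥ x)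
          + fun x => k (g t *ᵥ x) - k x := by
      funext x
      have : ((n + 1 : ℕ) : ℝ) * t = n * t + t := by push_cast; ring
      simp only [this, hadd, Pi.add_apply, Function.comp_apply, Matrix.mulVec_mulVec]
      ring
    rw [hsplit]
    refine (eLpNorm_add_le ((hm _).comp (measurePreserving_mulVec _ (hdet t)).measurable).aestronglyMeasurable
      (hm t).aestronglyMeasurable (by norm_num)).trans ?_
    rw [eLpNorm_comp_measurePreserving (hm _).aestronglyMeasurable (measurePreserving_mulVec _ (hdet t))]
    push_cast
    rw [add_mul, one_mul]
    gcongr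

/-- The `L²` mass of `k` on a set and on its preimage under a volume preserving map `g` differ by at
most the `L²` distance between `k` and `k ∘ g`. -/
lemma eLpNorm_restrict_preimage_le {g : (Fin 2 → ℝ) → (Fin 2 → ℝ)} (hg : MeasurePreserving g volume volume)
    (hk : Measurable k) {E : Set (Fin 2 → ℝ)} (hE : MeasurableSet E) :
    eLpNorm k 2 (volume.restrict (g ⁻¹' E))
        ≤ eLpNorm k 2 (volume.restrict E) + eLpNorm (fun x => k (g x) - k x) 2 volume ∧
    eLpNorm k 2 (volume.restrict E)
        ≤ eLpNorm k 2 (volume.restrict (g ⁻¹' E)) + eLpNorm (fun x => k (g x) - k x) 2 volume := by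
  have hmg := hk.comp hg.measurable
  have h1 : eLpNorm (k ∘ g) 2 (volume.restrict (g ⁻¹' E)) = eLpNorm k 2 (volume.restrict E) :=
    eLpNorm_comp_measurePreserving hk.aestronglyMeasurable (hg.restrict_preimage hE)
  have hd : eLpNorm (fun x => k (g x) - k x) 2 (volume.restrict (g ⁻¹' E))
      ≤ eLpNorm (fun x => k (g x) - k x) 2 volume := eLpNorm_mono_measure _ Measure.restrict_le_self
  constructor
  · have : k = (k ∘ g) - fun x => k (g x) - k x := by funext x; simp
    calc eLpNorm k 2 (volume.restrict (g ⁻¹' E))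
        = eLpNorm ((k ∘ g) - fun x => k (g x) - k x) 2 (volume.restrict (g ⁻¹' E)) := by rw [← this]
      _ ≤ _ := eLpNorm_sub_le hmg.aestronglyMeasurable (hmg.sub hk).aestronglyMeasurable (by norm_num)
      _ ≤ _ := by rw [h1]; gcongr
  · have : k ∘ g = k + fun x => k (g x) - k x := by funext x; simp
    rw [← h1]
    calc eLpNorm (k ∘ g) 2 (volume.restrict (g ⁻¹' E))
        = eLpNorm (k + fun x => k (g x) - k x) 2 (volume.restrict (g ⁻¹' E)) := by rw [← this]
      _ ≤ _ := eLpNorm_add_le hk.aestronglyMeasurable (hmg.sub hk).aestronglyMeasurable (by norm_num)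
      _ ≤ _ := by gcongr

lemma eLpNorm_two_sq {α : Type*} [MeasurableSpace α] (f : α → ℝ) (ν : Measure α) :
    eLpNorm f 2 ν ^ 2 = ∫⁻ x, ‖f x‖ₑ ^ 2 ∂ν := by
  rw [eLpNorm_eq_lintegral_rpow_enorm_toReal (by norm_num) (by norm_num)]
  rw [← ENNReal.rpow_natCast, ← ENNReal.rpow_mul]
  simp

lemma eLpNorm_restrict_sq_add_le {E E' S : Set (Fin 2 → ℝ)} (hE' : MeasurableSet E')
    (hd : Disjoint E E') (h1 : E ⊆ S) (h2 : E' ⊆ S) :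
    eLpNorm k 2 (volume.restrict E) ^ 2 + eLpNorm k 2 (volume.restrict E') ^ 2
      ≤ eLpNorm k 2 (volume.restrict S) ^ 2 := by
  simp only [eLpNorm_two_sq]
  rw [← lintegral_union hE' hd]
  exact lintegral_mono_set (Set.union_subset h1 h2)

/-- The pigeonhole step: if a mass `q` is at most `D` above each of two masses carried by disjoint
pieces, then it is small. -/
lemma le_four_mul_of_two_pieces {q e₁ e₂ D : ℝ≥0∞} (hq : q ≠ ∞) (h1 : q ≤ e₁ + D) (h2 : q ≤ e₂ + D)
    (h : e₁ ^ 2 + e₂ ^ 2 ≤ q ^ 2) : q ≤ 4 * D := by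
  by_cases hD : D = ∞
  · simp [hD]
  have hq2 : q ^ 2 ≠ ∞ := by finiteness
  have he1 : e₁ ≠ ∞ := by
    rintro rfl
    simp at h
    exact hq h
  have he2 : e₂ ≠ ∞ := by
    rintro rfl
    simp at h
    exact hq h
  lift q to NNReal using hq
  lift D to NNReal using hD
  lift e₁ to NNReal using he1
  lift e₂ to NNReal using he2
  norm_cast at *
  have hq0 := q.2
  have hD0 := D.2
  have a0 := e₁.2
  have b0 := e₂.2
  rw [← NNReal.coe_le_coe] at *
  push_cast at *
  by_contra hcon
  push Not at hcon
  nlinarith [NNReal.coe_nonneg q, NNReal.coe_nonneg D, NNReal.coe_nonneg e₁, NNReal.coe_nonneg e₂]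

/-- The upper unipotent matrix. -/
def upperShear (t : ℝ) : Matrix (Fin 2) (Fin 2) ℝ := !![1, t; 0, 1]

/-- The lower unipotent matrix. -/
def lowerShear (t : ℝ) : Matrix (Fin 2) (Fin 2) ℝ := !![1, 0; t, 1]

@[simp] lemma det_upperShear (t : ℝ) : (upperShear t).det = 1 := by
  simp [upperShear, Matrix.det_fin_two]

@[simp] lemma det_lowerShear (t : ℝ) : (lowerShear t).det = 1 := by
  simp [lowerShear, Matrix.det_fin_two]

lemma upperShear_mulVec (t : ℝ) (x : Fin 2 → ℝ) : upperShear t *ᵥ x = ![x 0 + t * x 1, x 1] := by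
  ext i; fin_cases i <;> simp [upperShear, Matrix.mulVec, dotProduct, Fin.sum_univ_two]

lemma lowerShear_mulVec (t : ℝ) (x : Fin 2 → ℝ) : lowerShear t *ᵥ x = ![x 0, t * x 0 + x 1] := by
  ext i; fin_cases i <;> simp [lowerShear, Matrix.mulVec, dotProduct, Fin.sum_univ_two]

/-- Ping-pong for the unit shears on the plane: a square integrable function which is moved by at
most `D` by both of them has norm `O(D)`.  The unit shears map the quadrants `x y > 0` into
disjoint parts of themselves, and so do their inverses with the quadrants `x y < 0`; so neither pair
of quadrants carries much mass. -/
lemma eLpNorm_sq_le_of_unit_shears (hk : Measurable k) (hk2 : eLpNorm k 2 volume ≠ ∞) {D : ℝ≥0∞}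
    (hU : eLpNorm (fun x => k (upperShear 1 *ᵥ x) - k x) 2 volume ≤ D)
    (hL : eLpNorm (fun x => k (lowerShear 1 *ᵥ x) - k x) 2 volume ≤ D) :
    eLpNorm k 2 volume ^ 2 ≤ 32 * D ^ 2 := by
  have mU := measurePreserving_mulVec (upperShear 1) (by simp)
  have mL := measurePreserving_mulVec (lowerShear 1) (by simp)
  set Qp : Set (Fin 2 → ℝ) := {x | 0 < x 0 * x 1} with hQp
  set Qm : Set (Fin 2 → ℝ) := {x | x 0 * x 1 < 0} with hQm
  set EU : Set (Fin 2 → ℝ) := {x | 0 < (x 0 - x 1) * x 1} with hEU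
  set EL : Set (Fin 2 → ℝ) := {x | 0 < (x 1 - x 0) * x 0} with hEL
  have meas : ∀ {f g : (Fin 2 → ℝ) → ℝ}, Measurable f → Measurable g → MeasurableSet {x | f x < g x} :=
    fun hf hg => measurableSet_lt hf hg
  have mQp : MeasurableSet Qp := meas (by fun_prop) (by fun_prop)
  have mQm : MeasurableSet Qm := meas (by fun_prop) (by fun_prop)
  have mEU : MeasurableSet EU := meas (by fun_prop) (by fun_prop)
  have mEL : MeasurableSet EL := meas (by fun_prop) (by fun_prop)
  have fin : ∀ S : Set (Fin 2 → ℝ), eLpNorm k 2 (volume.restrict S) ≠ ∞ := fun S =>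
    ne_top_of_le_ne_top hk2 (eLpNorm_mono_measure _ Measure.restrict_le_self)
  have pU : (fun x => upperShear 1 *ᵥ x) ⁻¹' EU = Qp := by
    ext x; simp only [Set.mem_preimage, upperShear_mulVec, hEU, hQp]; simp
  have pL : (fun x => lowerShear 1 *ᵥ x) ⁻¹' EL = Qp := by
    ext x; simp only [Set.mem_preimage, lowerShear_mulVec, hEL, hQp]; simp [mul_comm]
  have hp : eLpNorm k 2 (volume.restrict Qp) ≤ 4 * D := by
    refine le_four_mul_of_two_pieces (fin _) (e₁ := eLpNorm k 2 (volume.restrict EU))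
      (e₂ := eLpNorm k 2 (volume.restrict EL)) ?_ ?_ ?_
    · rw [← pU]; exact (eLpNorm_restrict_preimage_le mU hk mEU).1.trans (by gcongr)
    · rw [← pL]; exact (eLpNorm_restrict_preimage_le mL hk mEL).1.trans (by gcongr)
    · refine eLpNorm_restrict_sq_add_le mEL ?_ ?_ ?_
      · rw [Set.disjoint_left]
        intro x h1 h2
        simp only [hEU, hEL, Set.mem_ofPred_eq] at h1 h2
        nlinarith [sq_nonneg (x 0 - x 1)]
      · intro x h1
        simp only [hEU, hQp, Set.mem_ofPred_eq] at h1 ⊢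
        nlinarith [sq_nonneg (x 1)]
      · intro x h1
        simp only [hEL, hQp, Set.mem_ofPred_eq] at h1 ⊢
        nlinarith [sq_nonneg (x 0)]
  have hm : eLpNorm k 2 (volume.restrict Qm) ≤ 4 * D := by
    refine le_four_mul_of_two_pieces (fin _)
      (e₁ := eLpNorm k 2 (volume.restrict ((fun x => upperShear 1 *ᵥ x) ⁻¹' Qm)))
      (e₂ := eLpNorm k 2 (volume.restrict ((fun x => lowerShear 1 *ᵥ x) ⁻¹' Qm))) ?_ ?_ ?_
    · exact (eLpNorm_restrict_preimage_le mU hk mQm).2.trans (by gcongr)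
    · exact (eLpNorm_restrict_preimage_le mL hk mQm).2.trans (by gcongr)
    · refine eLpNorm_restrict_sq_add_le (mL.measurable mQm) ?_ ?_ ?_
      · rw [Set.disjoint_left]
        intro x h1 h2
        simp only [Set.mem_preimage, upperShear_mulVec, lowerShear_mulVec, hQm] at h1 h2
        simp at h1 h2
        nlinarith [sq_nonneg (x 0 + x 1)]
      · intro x h1
        simp only [Set.mem_preimage, upperShear_mulVec, hQm] at h1 ⊢
        simp at h1 ⊢
        nlinarith [sq_nonneg (x 1)]
      · intro x h1
        simp only [Set.mem_preimage, lowerShear_mulVec, hQm] at h1 ⊢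
        simp at h1 ⊢
        nlinarith [sq_nonneg (x 0)]
  have hnull : volume (Qp ∪ Qm)ᶜ = 0 := by
    refine measure_mono_null (t := {x | x 0 = 0} ∪ {x | x 1 = 0}) ?_
      (measure_union_null (Measure.pi_hyperplane (fun _ : Fin 2 => (volume : Measure ℝ)) 0 0)
        (Measure.pi_hyperplane (fun _ : Fin 2 => (volume : Measure ℝ)) 1 0))
    intro x hx
    simp only [hQp, hQm, Set.mem_compl_iff, Set.mem_union, Set.mem_ofPred_eq, not_or, not_lt] at hx
    exact mul_eq_zero.1 (le_antisymm hx.1 hx.2)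
  have hdisj : Disjoint Qp Qm := by
    rw [Set.disjoint_left]; intro x h1 h2; exact lt_asymm (a := (0:ℝ)) h1 h2
  have htot : eLpNorm k 2 volume ^ 2
      = eLpNorm k 2 (volume.restrict Qp) ^ 2 + eLpNorm k 2 (volume.restrict Qm) ^ 2 := by
    simp only [eLpNorm_two_sq]
    rw [← lintegral_union mQm hdisj, ← lintegral_add_compl _ (mQp.union mQm),
      setLIntegral_measure_zero _ _ hnull, add_zero]
  calc eLpNorm k 2 volume ^ 2 ≤ (4 * D) ^ 2 + (4 * D) ^ 2 := by rw [htot]; gcongr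
    _ = 32 * D ^ 2 := by ring

/-- **Spectral gap.** Averaging a square integrable function over the identity and two small
shears decreases its `L²` norm by a definite factor. The defect is the sum of the squares of the
differences `k ∘ g - k`, and these cannot be small, because `N` shears of size `1 / N` make up a unit
shear, to which the ping-pong estimate applies. -/
lemma lintegral_sq_average_shears_le (k : (Fin 2 → ℝ) → ℝ≥0∞) (hk : Measurable k) {N : ℕ} (hN : 0 < N) :
    ∫⁻ x, ((k x + k (upperShear (1 / N) *ᵥ x) + k (lowerShear (1 / N) *ᵥ x)) / 3) ^ 2
      ≤ (1 - 1 / (288 * (N : ℝ≥0∞) ^ 2)) * ∫⁻ x, k x ^ 2 := by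
  have mu := measurePreserving_mulVec (upperShear (1 / N)) (by simp)
  have ml := measurePreserving_mulVec (lowerShear (1 / N)) (by simp)
  set I := ∫⁻ x, k x ^ 2 with hI
  have hN0 : (N : ℝ≥0∞) ≠ 0 := by exact_mod_cast hN.ne'
  have hNr : (N : ℝ) ≠ 0 := by exact_mod_cast hN.ne'
  have hfac : 1 / (288 * (N : ℝ≥0∞) ^ 2) < 1 := by
    rw [one_div, ENNReal.inv_lt_one]
    have : (1 : ℝ≥0∞) ≤ (N : ℝ≥0∞) ^ 2 := by exact_mod_cast Nat.one_le_pow _ _ hN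
    calc (1 : ℝ≥0∞) < 288 * 1 := by norm_num
      _ ≤ _ := by gcongr
  by_cases hItop : I = ∞
  · rw [hItop, ENNReal.mul_top (tsub_pos_of_lt hfac).ne']
    exact le_top
  have hfin : ∀ᵐ x, k x < ∞ := by
    filter_upwards [ae_lt_top (hk.pow_const 2) hItop] with x hx
    by_contra h
    simp [not_lt, top_le_iff] at h
    simp [h] at hx
  set κ : (Fin 2 → ℝ) → ℝ := fun x => (k x).toReal with hκ
  have mκ : Measurable κ := hk.ennreal_toReal
  have hnorm : eLpNorm κ 2 volume ^ 2 = I := by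
    rw [eLpNorm_two_sq, hI]
    refine lintegral_congr_ae ?_
    filter_upwards [hfin] with x hx
    rw [hκ, Real.enorm_eq_ofReal ENNReal.toReal_nonneg, ENNReal.ofReal_toReal hx.ne]
  set dU := eLpNorm (fun x => κ (upperShear (1 / N) *ᵥ x) - κ x) 2 volume with hdU
  set dL := eLpNorm (fun x => κ (lowerShear (1 / N) *ᵥ x) - κ x) 2 volume with hdL
  -- `N` steps of size `1 / N` add up to a unit shear
  have hU : eLpNorm (fun x => κ (upperShear 1 *ᵥ x) - κ x) 2 volume ≤ N * dU := by
    have := eLpNorm_comp_pow_sub_le (k := κ) (g := upperShear)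
      (fun s t => by simp [upperShear, add_comm]) (by simp [upperShear, Matrix.one_fin_two])
      (fun s => by simp) mκ (1 / N) N
    rwa [mul_one_div_cancel hNr] at this
  have hL : eLpNorm (fun x => κ (lowerShear 1 *ᵥ x) - κ x) 2 volume ≤ N * dL := by
    have := eLpNorm_comp_pow_sub_le (k := κ) (g := lowerShear)
      (fun s t => by simp [lowerShear]) (by simp [lowerShear, Matrix.one_fin_two])
      (fun s => by simp) mκ (1 / N) N
    rwa [mul_one_div_cancel hNr] at this
  have hI32 : I ≤ 32 * N ^ 2 * (dU ^ 2 + dL ^ 2) := by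
    have htop : eLpNorm κ 2 volume ≠ ∞ := by
      intro h
      rw [h] at hnorm
      exact hItop (by rw [← hnorm]; simp)
    have := eLpNorm_sq_le_of_unit_shears mκ htop (D := N * max dU dL)
      (hU.trans (by gcongr; exact le_max_left _ _)) (hL.trans (by gcongr; exact le_max_right _ _))
    rw [hnorm] at this
    refine this.trans ?_
    rw [mul_pow, ← mul_assoc]
    gcongr
    rcases le_total dU dL with h | h
    · rw [max_eq_right h]; exact le_add_self
    · rw [max_eq_left h]; exact le_self_add
  have hpoint : ∀ᵐ x, 9 * ((k x + k (upperShear (1 / N) *ᵥ x) + k (lowerShear (1 / N) *ᵥ x)) / 3) ^ 2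
      + (‖κ (upperShear (1 / N) *ᵥ x) - κ x‖ₑ ^ 2 + ‖κ (lowerShear (1 / N) *ᵥ x) - κ x‖ₑ ^ 2)
      ≤ 3 * (k x ^ 2 + k (upperShear (1 / N) *ᵥ x) ^ 2 + k (lowerShear (1 / N) *ᵥ x) ^ 2) := by
    filter_upwards [hfin, mu.quasiMeasurePreserving.ae hfin, ml.quasiMeasurePreserving.ae hfin]
      with x h1 h2 h3
    have e : ∀ y, k y < ∞ → k y = ENNReal.ofReal (κ y) := fun y hy => by
      rw [hκ, ENNReal.ofReal_toReal hy.ne]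
    have p : ∀ y, 0 ≤ κ y := fun y => ENNReal.toReal_nonneg
    rw [e _ h1, e _ h2, e _ h3]
    have en : ∀ r : ℝ, ‖r‖ₑ ^ 2 = ENNReal.ofReal (r ^ 2) := fun r => by
      rw [Real.enorm_eq_ofReal_abs, ← ENNReal.ofReal_pow (abs_nonneg r), sq_abs]
    rw [en, en]
    have ha := p x
    have hb := p (upperShear (1 / N) *ᵥ x)
    have hc := p (lowerShear (1 / N) *ᵥ x)
    revert ha hb hc
    generalize κ x = a
    generalize κ (upperShear (1 / N) *ᵥ x) = b
    generalize κ (lowerShear (1 / N) *ᵥ x) = c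
    intro ha hb hc
    have h3 : (3 : ℝ≥0∞) = ENNReal.ofReal 3 := by simp
    have h9 : (9 : ℝ≥0∞) = ENNReal.ofReal 9 := by simp
    rw [h3, h9, ← ENNReal.ofReal_add ha hb, ← ENNReal.ofReal_add (add_nonneg ha hb) hc,
      ← ENNReal.ofReal_div_of_pos (by norm_num), ← ENNReal.ofReal_pow (by positivity),
      ← ENNReal.ofReal_mul (by norm_num), ← ENNReal.ofReal_add (by positivity) (by positivity),
      ← ENNReal.ofReal_add (by positivity) (by positivity), ← ENNReal.ofReal_pow ha,
      ← ENNReal.ofReal_pow hb, ← ENNReal.ofReal_pow hc,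
      ← ENNReal.ofReal_add (by positivity) (by positivity),
      ← ENNReal.ofReal_add (by positivity) (by positivity), ← ENNReal.ofReal_mul (by norm_num)]
    apply ENNReal.ofReal_le_ofReal
    nlinarith [sq_nonneg (b - c)]
  have hint : 9 * (∫⁻ x, ((k x + k (upperShear (1 / N) *ᵥ x) + k (lowerShear (1 / N) *ᵥ x)) / 3) ^ 2)
      + (dU ^ 2 + dL ^ 2) ≤ 9 * I := by
    have h := lintegral_mono_ae hpoint
    have m1 : Measurable fun x => k (upperShear (1 / N) *ᵥ x) := hk.comp mu.measurable
    have m2 : Measurable fun x => k (lowerShear (1 / N) *ᵥ x) := hk.comp ml.measurable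
    have m3 : Measurable fun x => ‖κ (upperShear (1 / N) *ᵥ x) - κ x‖ₑ ^ 2 :=
      ((mκ.comp mu.measurable).sub mκ).enorm.pow_const 2
    have m4 : Measurable fun x => ‖κ (lowerShear (1 / N) *ᵥ x) - κ x‖ₑ ^ 2 :=
      ((mκ.comp ml.measurable).sub mκ).enorm.pow_const 2
    have m34 : Measurable fun x => ‖κ (upperShear (1 / N) *ᵥ x) - κ x‖ₑ ^ 2
        + ‖κ (lowerShear (1 / N) *ᵥ x) - κ x‖ₑ ^ 2 := m3.add m4
    rw [lintegral_add_right _ m34, lintegral_add_right _ m4,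
      lintegral_const_mul _ (by fun_prop), lintegral_const_mul _ (by fun_prop),
      lintegral_add_right _ (m2.pow_const 2), lintegral_add_right _ (m1.pow_const 2),
      mu.lintegral_comp (hk.pow_const 2), ml.lintegral_comp (hk.pow_const 2),
      ← eLpNorm_two_sq, ← eLpNorm_two_sq] at h
    refine h.trans (le_of_eq ?_)
    rw [← hI]; ring
  generalize (∫⁻ x, ((k x + k (upperShear (1 / N) *ᵥ x) + k (lowerShear (1 / N) *ᵥ x)) / 3) ^ 2) = J at *
  generalize dU ^ 2 + dL ^ 2 = d at *
  rw [ENNReal.sub_mul (fun _ _ => hItop), one_mul]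
  refine ENNReal.le_sub_of_add_le_right (by finiteness) ?_
  have hNI : 1 / (32 * (N : ℝ≥0∞) ^ 2) * I ≤ d := by
    rw [one_div]
    exact ENNReal.inv_mul_le_iff (by positivity) (by finiteness) |>.2 hI32
  refine (ENNReal.mul_le_mul_iff_right (a := 9) (by norm_num) (by norm_num)).1 ?_
  refine le_trans ?_ hint
  rw [mul_add, ← mul_assoc]
  gcongr
  refine le_trans (le_of_eq ?_) hNI
  congr 1
  rw [one_div, one_div, show (288 : ℝ≥0∞) * N ^ 2 = 9 * (32 * N ^ 2) by ring,
    ENNReal.mul_inv (by simp) (by simp), ← mul_assoc, ENNReal.mul_inv_cancel (by simp) (by simp),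
    one_mul]
end PingPong

/-! ### Shearing frames by matrices close to the identity -/

instance {m n : Type*} : MeasurableSpace (Matrix m n ℝ) :=
  inferInstanceAs (MeasurableSpace (m → n → ℝ))

instance {m n : Type*} [Countable m] [Countable n] : BorelSpace (Matrix m n ℝ) :=
  inferInstanceAs (BorelSpace (m → n → ℝ))

instance {m n : Type*} [Countable m] [Countable n] : SecondCountableTopology (Matrix m n ℝ) :=
  inferInstanceAs (SecondCountableTopology (m → n → ℝ))

/-- Lebesgue measure on the space of matrices. -/
noncomputable instance {m n : Type*} [Fintype m] [Fintype n] : MeasureSpace (Matrix m n ℝ) where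
  volume := (volume : Measure (m → n → ℝ))

/-- The cofactor matrix. For invertible `M` it is `det M` times the inverse transpose, and it
represents the action of `M` on the exterior square, i.e. on oriented planes. -/
def cofactorMatrix (M : Matrix (Fin 3) (Fin 3) ℝ) : Matrix (Fin 3) (Fin 3) ℝ := M.adjugateᵀ

lemma cofactorMatrix_mul (M M' : Matrix (Fin 3) (Fin 3) ℝ) :
    cofactorMatrix (M * M') = cofactorMatrix M * cofactorMatrix M' := by
  simp [cofactorMatrix, Matrix.adjugate_mul_distrib, Matrix.transpose_mul]

/-- A multiplicative action of `3 × 3` matrices on `3`-space for which every shear of every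
orthonormal pair `W` is induced by a matrix `1 + t E` of determinant one, with bounded `E`.
The two examples are the standard action and the action by cofactor matrices. -/
structure ShearsFrames (c : Matrix (Fin 3) (Fin 3) ℝ → Matrix (Fin 3) (Fin 3) ℝ) : Prop where
  continuous : Continuous c
  map_mul : ∀ M M', c (M * M') = c M * c M'
  upper : ∀ W : Matrix (Fin 3) (Fin 2) ℝ, Wᵀ * W = 1 → ∀ t : ℝ,
    ∃ E : Matrix (Fin 3) (Fin 3) ℝ, (∀ i j, |E i j| ≤ 1) ∧ (1 + t • E).det = 1 ∧
      c (1 + t • E) * W = W * upperShear t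
  lower : ∀ W : Matrix (Fin 3) (Fin 2) ℝ, Wᵀ * W = 1 → ∀ t : ℝ,
    ∃ E : Matrix (Fin 3) (Fin 3) ℝ, (∀ i j, |E i j| ≤ 1) ∧ (1 + t • E).det = 1 ∧
      c (1 + t • E) * W = W * lowerShear t

section Orthonormal

variable {W : Matrix (Fin 3) (Fin 2) ℝ}

lemma abs_le_one_of_transpose_mul_self (hW : Wᵀ * W = 1) (i : Fin 3) (a : Fin 2) : |W i a| ≤ 1 := by
  have h : (Wᵀ * W) a a = 1 := by rw [hW]; simp
  rw [Matrix.mul_apply] at h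
  simp only [Matrix.transpose_apply] at h
  rw [← sq_le_one_iff_abs_le_one, ← h, sq]
  exact Finset.single_le_sum (f := fun j => W j a * W j a) (fun j _ => mul_self_nonneg _)
    (Finset.mem_univ i)

lemma abs_mul_single_mul_transpose_le (hW : Wᵀ * W = 1) (a b : Fin 2) (i j : Fin 3) :
    |(W * Matrix.single a b (1 : ℝ) * Wᵀ) i j| ≤ 1 := by
  have : (W * Matrix.single a b (1 : ℝ) * Wᵀ) i j = W i a * W j b := by
    fin_cases a <;> fin_cases b <;>
      simp [Matrix.mul_apply, Fin.sum_univ_two, Matrix.single_apply]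
  rw [this, abs_mul]
  exact mul_le_one₀ (abs_le_one_of_transpose_mul_self hW i a) (abs_nonneg _)
    (abs_le_one_of_transpose_mul_self hW j b)

lemma det_one_add_smul_mul_transpose (hW : Wᵀ * W = 1) (e : Matrix (Fin 2) (Fin 2) ℝ) :
    (1 + W * e * Wᵀ).det = (1 + e).det := by
  rw [Matrix.mul_assoc, Matrix.det_one_add_mul_comm, Matrix.mul_assoc, hW, Matrix.mul_one]

lemma one_add_mul_transpose_mul (hW : Wᵀ * W = 1) (e : Matrix (Fin 2) (Fin 2) ℝ) :
    (1 + W * e * Wᵀ) * W = W * (1 + e) := by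
  rw [Matrix.add_mul, Matrix.one_mul, Matrix.mul_assoc, hW, Matrix.mul_one, Matrix.mul_add,
    Matrix.mul_one]

lemma smul_mul_transpose (W : Matrix (Fin 3) (Fin 2) ℝ) (e : Matrix (Fin 2) (Fin 2) ℝ) (t : ℝ) :
    t • (W * e * Wᵀ) = W * (t • e) * Wᵀ := by simp

lemma upperShear_eq (t : ℝ) : upperShear t = 1 + t • Matrix.single 0 1 1 := by
  ext i j; fin_cases i <;> fin_cases j <;> simp [upperShear]

lemma lowerShear_eq (t : ℝ) : lowerShear t = 1 + t • Matrix.single 1 0 1 := by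
  ext i j; fin_cases i <;> fin_cases j <;> simp [lowerShear]

/-- The cofactor matrix of a transvection along a plane is the contragredient transvection. -/
lemma cofactorMatrix_one_add_mul_transpose (hW : Wᵀ * W = 1) {e : Matrix (Fin 2) (Fin 2) ℝ}
    (he : e * e = 0) (hdet : (1 + e).det = 1) :
    cofactorMatrix (1 - W * e * Wᵀ) = 1 + W * eᵀ * Wᵀ := by
  have hinv : (1 - W * e * Wᵀ) * (1 + W * e * Wᵀ) = 1 := by
    have h0 : W * e * Wᵀ * (W * e * Wᵀ) = 0 := by
      calc W * e * Wᵀ * (W * e * Wᵀ) = W * (e * ((Wᵀ * W) * e)) * Wᵀ := by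
            simp only [Matrix.mul_assoc]
        _ = 0 := by rw [hW, Matrix.one_mul, he]; simp
    rw [sub_mul, mul_add, mul_add, h0]
    simp
  have hd : (1 - W * e * Wᵀ).det = 1 := by
    have h1 := congrArg Matrix.det hinv
    rw [Matrix.det_mul, det_one_add_smul_mul_transpose hW, hdet] at h1
    simpa using h1
  have hadj : (1 - W * e * Wᵀ).adjugate = 1 + W * e * Wᵀ := by
    calc (1 - W * e * Wᵀ).adjugate
        = (1 - W * e * Wᵀ).adjugate * ((1 - W * e * Wᵀ) * (1 + W * e * Wᵀ)) := by
          rw [hinv, Matrix.mul_one]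
      _ = _ := by rw [← Matrix.mul_assoc, Matrix.adjugate_mul, hd]; simp
  rw [cofactorMatrix, hadj]
  simp [Matrix.transpose_mul, Matrix.mul_assoc]

/-- The elementary nilpotent matrix, with its only nonzero entry at `(a, b)`. -/
abbrev unitMatrix (a b : Fin 2) : Matrix (Fin 2) (Fin 2) ℝ := Matrix.single a b 1

lemma det_one_add_smul_unitMatrix {a b : Fin 2} (hab : a ≠ b) (t : ℝ) :
    (1 + t • unitMatrix a b).det = 1 := by
  fin_cases a <;> fin_cases b <;> simp [Matrix.det_fin_two] at hab ⊢

lemma exists_mul_eq_mul_shear (hW : Wᵀ * W = 1) {a b : Fin 2} (hab : a ≠ b) (t : ℝ) :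
    ∃ E : Matrix (Fin 3) (Fin 3) ℝ, (∀ i j, |E i j| ≤ 1) ∧ (1 + t • E).det = 1 ∧
      (1 + t • E) * W = W * (1 + t • unitMatrix a b) := by
  refine ⟨W * unitMatrix a b * Wᵀ, abs_mul_single_mul_transpose_le hW a b, ?_, ?_⟩
  · rw [smul_mul_transpose, det_one_add_smul_mul_transpose hW, det_one_add_smul_unitMatrix hab]
  · rw [smul_mul_transpose, one_add_mul_transpose_mul hW]

lemma exists_cofactorMatrix_mul_eq_mul_shear (hW : Wᵀ * W = 1) {a b : Fin 2} (hab : a ≠ b) (t : ℝ) :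
    ∃ E : Matrix (Fin 3) (Fin 3) ℝ, (∀ i j, |E i j| ≤ 1) ∧ (1 + t • E).det = 1 ∧
      cofactorMatrix (1 + t • E) * W = W * (1 + t • unitMatrix a b) := by
  -- the contragredient of the shear with matrix `1 + t • unitMatrix a b`
  have he : 1 + t • -(W * unitMatrix b a * Wᵀ) = 1 - W * (t • unitMatrix b a) * Wᵀ := by
    rw [smul_neg, smul_mul_transpose, sub_eq_add_neg]
  refine ⟨-(W * unitMatrix b a * Wᵀ), fun i j => ?_, ?_, ?_⟩
  · rw [Matrix.neg_apply, abs_neg]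
    exact abs_mul_single_mul_transpose_le hW b a i j
  · have := det_one_add_smul_mul_transpose hW ((-t) • unitMatrix b a)
    rwa [det_one_add_smul_unitMatrix hab.symm, neg_smul, Matrix.mul_neg, Matrix.neg_mul,
      ← sub_eq_add_neg, ← he] at this
  · rw [he, cofactorMatrix_one_add_mul_transpose hW (by simp [hab])
      (det_one_add_smul_unitMatrix hab.symm t), one_add_mul_transpose_mul hW]
    simp

end Orthonormal

lemma shearsFrames_id : ShearsFrames id where
  continuous := continuous_id
  map_mul _ _ := rfl
  upper W hW t := by
    simpa only [upperShear_eq, id] using exists_mul_eq_mul_shear hW zero_ne_one t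
  lower W hW t := by
    simpa only [lowerShear_eq, id] using exists_mul_eq_mul_shear hW one_ne_zero t

lemma shearsFrames_cofactorMatrix : ShearsFrames cofactorMatrix where
  continuous := by unfold cofactorMatrix; fun_prop
  map_mul := cofactorMatrix_mul
  upper W hW t := by
    simpa only [upperShear_eq] using exists_cofactorMatrix_mul_eq_mul_shear hW zero_ne_one t
  lower W hW t := by
    simpa only [lowerShear_eq] using exists_cofactorMatrix_mul_eq_mul_shear hW one_ne_zero t

/-- Gram-Schmidt for two columns. -/
lemma exists_orthonormal_mul (M : Matrix (Fin 3) (Fin 2) ℝ) (hM : ¬ ∃ v ≠ 0, M *ᵥ v = 0) :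
    ∃ (W : Matrix (Fin 3) (Fin 2) ℝ) (g : Matrix (Fin 2) (Fin 2) ℝ),
      Wᵀ * W = 1 ∧ g.det ≠ 0 ∧ M = W * g := by
  set S := Mᵀ * M with hS
  have hdet : S.det ≠ 0 := by
    intro h
    obtain ⟨v, hv, hv0⟩ := Matrix.exists_mulVec_eq_zero_iff.2 h
    refine hM ⟨v, hv, ?_⟩
    have := Matrix.conjTranspose_mul_self_mulVec_eq_zero M v
    rw [Matrix.conjTranspose_eq_transpose_of_trivial] at this
    exact this.1 hv0
  have h00 : S 0 0 = M 0 0 ^ 2 + M 1 0 ^ 2 + M 2 0 ^ 2 := by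
    simp [hS, Matrix.mul_apply, Fin.sum_univ_three]; ring
  have h01 : S 0 1 = M 0 0 * M 0 1 + M 1 0 * M 1 1 + M 2 0 * M 2 1 := by
    simp [hS, Matrix.mul_apply, Fin.sum_univ_three]
  have h10 : S 1 0 = S 0 1 := by
    simp [hS, Matrix.mul_apply, Fin.sum_univ_three]; ring
  have h11 : S 1 1 = M 0 1 ^ 2 + M 1 1 ^ 2 + M 2 1 ^ 2 := by
    simp [hS, Matrix.mul_apply, Fin.sum_univ_three]; ring
  have hdet' : S.det = S 0 0 * S 1 1 - S 0 1 ^ 2 := by rw [Matrix.det_fin_two, h10]; ring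
  have hpos : 0 < S 0 0 * S 1 1 - S 0 1 ^ 2 := by
    refine lt_of_le_of_ne ?_ (by rw [← hdet']; exact hdet.symm)
    rw [h00, h01, h11]
    nlinarith [sq_nonneg (M 0 0 * M 1 1 - M 1 0 * M 0 1), sq_nonneg (M 0 0 * M 2 1 - M 2 0 * M 0 1),
      sq_nonneg (M 1 0 * M 2 1 - M 2 0 * M 1 1)]
  have ha : 0 < S 0 0 := by
    refine lt_of_le_of_ne (by rw [h00]; positivity) fun h => ?_
    rw [← h] at hpos
    nlinarith [sq_nonneg (S 0 1)]
  set α := √(S 0 0) with hα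
  have hα0 : 0 < α := Real.sqrt_pos.2 ha
  have hα2 : α ^ 2 = S 0 0 := Real.sq_sqrt ha.le
  set γ := √(S 1 1 - (S 0 1 / α) ^ 2) with hγ
  have hγp : 0 < S 1 1 - (S 0 1 / α) ^ 2 := by
    rw [div_pow, hα2, sub_pos, div_lt_iff₀ ha]; linarith
  have hγ0 : 0 < γ := Real.sqrt_pos.2 hγp
  have hγ2 : γ ^ 2 = S 1 1 - (S 0 1 / α) ^ 2 := Real.sq_sqrt hγp.le
  set g : Matrix (Fin 2) (Fin 2) ℝ := !![α, S 0 1 / α; 0, γ] with hg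
  have hgd : g.det ≠ 0 := by
    rw [hg, Matrix.det_fin_two]; simp [hα0.ne', hγ0.ne']
  have hgg : gᵀ * g = S := by
    ext i j
    fin_cases i <;> fin_cases j
    · simp [hg, Matrix.mul_apply, Fin.sum_univ_two, ← hα2]; ring
    · simp [hg, Matrix.mul_apply, Fin.sum_univ_two]; field_simp
    · simp [hg, Matrix.mul_apply, Fin.sum_univ_two, h10]; field_simp
    · simp [hg, Matrix.mul_apply, Fin.sum_univ_two]; rw [← sq γ, hγ2]; ring
  have hu : IsUnit g.det := hgd.isUnit
  refine ⟨M * g⁻¹, g, ?_, hgd, ?_⟩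
  · calc (M * g⁻¹)ᵀ * (M * g⁻¹) = (g⁻¹)ᵀ * (Mᵀ * M) * g⁻¹ := by
          simp only [Matrix.transpose_mul, Matrix.mul_assoc]
      _ = (g⁻¹)ᵀ * gᵀ * (g * g⁻¹) := by rw [← hS, ← hgg]; simp only [Matrix.mul_assoc]
      _ = 1 := by rw [← Matrix.transpose_mul, Matrix.mul_nonsing_inv _ hu]; simp
  · rw [Matrix.mul_assoc, Matrix.nonsing_inv_mul _ hu, Matrix.mul_one]

/-! ### Frame functions and their contraction by one random step -/

/-- Lebesgue measure on the cube of `3 × 3` matrices with entries of absolute value at most `r`. -/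
noncomputable def boxMeasure (r : ℝ) : Measure (Matrix (Fin 3) (Fin 3) ℝ) :=
  volume.restrict {X | ∀ i j, |X i j| ≤ r}

lemma box_eq_pi (r : ℝ) : {X : Fin 3 → Fin 3 → ℝ | ∀ i j, |X i j| ≤ r}
    = Set.univ.pi fun _ => Set.univ.pi fun _ => Set.Icc (-r) r := by
  ext X; simp only [abs_le, Set.mem_pi, Set.mem_univ, Set.mem_Icc, forall_true_left]; rfl

lemma measurableSet_box (r : ℝ) :
    MeasurableSet {X : Matrix (Fin 3) (Fin 3) ℝ | ∀ i j, |X i j| ≤ r} := by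
  change MeasurableSet {X : Fin 3 → Fin 3 → ℝ | ∀ i j, |X i j| ≤ r}
  rw [box_eq_pi]
  exact MeasurableSet.univ_pi fun _ => MeasurableSet.univ_pi fun _ => measurableSet_Icc

lemma boxMeasure_univ (r : ℝ) : boxMeasure r Set.univ = ENNReal.ofReal (2 * r) ^ 9 := by
  rw [boxMeasure, Measure.restrict_apply_univ]
  change volume {X : Fin 3 → Fin 3 → ℝ | ∀ i j, |X i j| ≤ r} = _
  rw [box_eq_pi, volume_pi_pi]
  simp only [volume_pi_pi, Real.volume_Icc, Finset.prod_const, Finset.card_univ, Fintype.card_fin,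
    ← pow_mul]
  congr 2; ring

instance (r : ℝ) : IsFiniteMeasure (boxMeasure r) := ⟨by rw [boxMeasure_univ]; finiteness⟩

/-- Right multiplication by a unimodular matrix followed by a translation preserves volume. -/
lemma measurePreserving_mul_add (G D : Matrix (Fin 3) (Fin 3) ℝ) (hG : G.det = 1) :
    MeasurePreserving (fun X : Matrix (Fin 3) (Fin 3) ℝ => X * G + D) volume volume := by
  have h1 : MeasurePreserving (fun (X : Fin 3 → Fin 3 → ℝ) (i : Fin 3) => Gᵀ *ᵥ X i) volume volume :=
    volume_preserving_pi fun _ => measurePreserving_mulVec Gᵀ (by simp [hG])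
  have h2 : MeasurePreserving (fun X : Fin 3 → Fin 3 → ℝ => X + fun i j => D i j) volume volume :=
    measurePreserving_add_right volume _
  have h := h2.comp h1
  have e : (fun X : Matrix (Fin 3) (Fin 3) ℝ => X * G + D)
      = (fun X : Fin 3 → Fin 3 → ℝ => X + fun i j => D i j) ∘ (fun X i => Gᵀ *ᵥ X i) := by
    funext X i j
    simp only [Function.comp_apply, Matrix.add_apply, Pi.add_apply, Matrix.mulVec_transpose]
    rfl
  rw [e]; exact h

/-- A volume preserving map from one cube into another transports Lebesgue measure on the first to a
measure below Lebesgue measure on the second. -/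
lemma map_boxMeasure_le {τ : Matrix (Fin 3) (Fin 3) ℝ → Matrix (Fin 3) (Fin 3) ℝ}
    (hτ : MeasurePreserving τ volume volume) {r s : ℝ}
    (hmaps : ∀ X : Matrix (Fin 3) (Fin 3) ℝ, (∀ i j, |X i j| ≤ r) → ∀ i j, |τ X i j| ≤ s) :
    (boxMeasure r).map τ ≤ boxMeasure s := by
  refine Measure.le_iff.2 fun S hS => ?_
  rw [Measure.map_apply hτ.measurable hS, boxMeasure, boxMeasure,
    Measure.restrict_apply (hτ.measurable hS), Measure.restrict_apply hS]
  calc _ ≤ volume (τ ⁻¹' (S ∩ {X | ∀ i j, |X i j| ≤ s})) :=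
        measure_mono fun X hX => ⟨hX.1, hmaps X hX.2⟩
    _ = _ := hτ.measure_preimage (hS.inter (measurableSet_box s)).nullMeasurableSet

lemma abs_mul_apply_le {X E : Matrix (Fin 3) (Fin 3) ℝ} {r : ℝ} (hX : ∀ i j, |X i j| ≤ r)
    (hE : ∀ i j, |E i j| ≤ 1) (i j : Fin 3) : |(X * E) i j| ≤ 3 * r := by
  rw [Matrix.mul_apply]
  calc |∑ k, X i k * E k j| ≤ ∑ k, |X i k * E k j| := Finset.abs_sum_le_sum_abs _ _
    _ ≤ ∑ _k : Fin 3, r := Finset.sum_le_sum fun k _ => by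
        rw [abs_mul]
        exact mul_le_of_le_one_right (abs_nonneg _) (hE k j) |>.trans (hX i k)
    _ = 3 * r := by simp

/-- Right multiplication of the perturbed matrix `A + ε X` by a matrix `1 + t E` close to the
identity amounts to a volume preserving change of the noise `X`, which maps the half-size cube
into the unit cube. -/
lemma exists_noise_change {A E : Matrix (Fin 3) (Fin 3) ℝ} {ε t : ℝ} (hA : ∀ i j, |A i j| ≤ 1)
    (hE : ∀ i j, |E i j| ≤ 1) (hε : 0 < ε) (hε1 : ε < 1) (ht : 0 ≤ t) (htε : 9 * t ≤ ε)
    (hdet : (1 + t • E).det = 1) :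
    ∃ τ : Matrix (Fin 3) (Fin 3) ℝ → Matrix (Fin 3) (Fin 3) ℝ, Measurable τ ∧
      (boxMeasure (1 / 2)).map τ ≤ boxMeasure 1 ∧
      ∀ X, A + ε • τ X = (A + ε • X) * (1 + t • E) := by
  refine ⟨fun X => X * (1 + t • E) + (t / ε) • (A * E), ?_, ?_, fun X => ?_⟩
  · exact (measurePreserving_mul_add _ _ hdet).measurable
  · refine map_boxMeasure_le (measurePreserving_mul_add _ _ hdet) fun X hX i j => ?_
    have h1 : (X * (1 + t • E) + (t / ε) • (A * E)) i j
        = X i j + (t * (X * E) i j + (t / ε) * (A * E) i j) := by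
      rw [Matrix.mul_add, Matrix.mul_one, Matrix.mul_smul]
      simp only [Matrix.add_apply, Matrix.smul_apply, smul_eq_mul]
      ring
    have hte : t / ε ≤ 1 / 9 := by rw [div_le_div_iff₀ hε (by norm_num)]; linarith
    have h2 := abs_mul_apply_le hX hE i j
    have h3 := abs_mul_apply_le hA hE i j
    have h4 : |t * (X * E) i j| ≤ 1 / 9 * (3 * (1 / 2)) := by
      rw [abs_mul, abs_of_nonneg ht]
      gcongr; linarith
    have h5 : |t / ε * (A * E) i j| ≤ 1 / 9 * (3 * 1) := by
      rw [abs_mul, abs_of_nonneg (by positivity : 0 ≤ t / ε)]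
      gcongr
    rw [h1]
    have h6 := hX i j
    calc _ ≤ _ := abs_add_le _ _
      _ ≤ |X i j| + (_ + _) := by gcongr; exact abs_add_le _ _
      _ ≤ 1 := by linarith
  · ext i j
    simp only [Matrix.mul_add, Matrix.add_mul, Matrix.mul_one, Matrix.mul_smul, Matrix.smul_mul,
      Matrix.add_apply, Matrix.smul_apply, smul_eq_mul]
    field_simp
    ring

/-- Cauchy-Schwarz against a constant. -/
lemma lintegral_sq_le {α : Type*} [MeasurableSpace α] (ν : Measure α) {f : α → ℝ≥0∞}
    (hf : AEMeasurable f ν) : (∫⁻ x, f x ∂ν) ^ 2 ≤ ν Set.univ * ∫⁻ x, f x ^ 2 ∂ν := by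
  have h := ENNReal.lintegral_mul_le_Lp_mul_Lq ν Real.HolderConjugate.two_two hf
    (aemeasurable_const (b := (1 : ℝ≥0∞)))
  have e : ∀ a : ℝ≥0∞, (a ^ (1 / 2 : ℝ)) ^ 2 = a := fun a => by
    rw [← ENNReal.rpow_natCast, ← ENNReal.rpow_mul]; simp
  calc (∫⁻ x, f x ∂ν) ^ 2 ≤ _ := by
        have := pow_le_pow_left' h 2
        simpa using this
    _ = _ := by
        rw [mul_pow, ← one_div, e, e, mul_comm]

/-- Convexity of the square for masses in the proportion `511 : 1`. -/
lemma div_sq_le_of_masses (a b : ℝ≥0∞) : ((a + b) / 512) ^ 2 ≤ (a ^ 2 / 511 + b ^ 2) / 512 := by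
  by_cases ha : a = ∞
  · simp [ha, ENNReal.top_div]
  by_cases hb : b = ∞
  · simp [hb, ENNReal.top_div]
  lift a to NNReal using ha
  lift b to NNReal using hb
  have : ((a + b) / 512) ^ 2 ≤ (a ^ 2 / 511 + b ^ 2) / 512 := by
    rw [← NNReal.coe_le_coe]
    push_cast
    nlinarith [sq_nonneg ((a : ℝ) - 511 * b)]
  have h5 : (512 : ℝ≥0∞) = ((512 : NNReal) : ℝ≥0∞) := by simp
  have h6 : (511 : ℝ≥0∞) = ((511 : NNReal) : ℝ≥0∞) := by simp
  rw [h5, h6]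
  rw [← ENNReal.coe_add, ← ENNReal.coe_div (by norm_num), ← ENNReal.coe_pow, ← ENNReal.coe_pow,
    ← ENNReal.coe_pow, ← ENNReal.coe_div (by norm_num), ← ENNReal.coe_add,
    ← ENNReal.coe_div (by norm_num)]
  exact_mod_cast this

/-- A family of functions on the plane `ℝ²`, one for each pair `M` of vectors in `ℝ³` seen as the
map `ℝ² → ℝ³`. Equivariance says that up to normalising areas, `F M x` depends only on the
plane spanned by `M` and the vector `M x` in it. The essential datum is the bound `C` on the
squared `L²` norms, which is uniform in `M`. -/
structure FrameFunction (F : Matrix (Fin 3) (Fin 2) ℝ → (Fin 2 → ℝ) → ℝ≥0∞) (C : ℝ≥0∞) : Prop where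
  measurable : Measurable fun p : Matrix (Fin 3) (Fin 2) ℝ × (Fin 2 → ℝ) => F p.1 p.2
  equivariant : ∀ M, ∀ g : Matrix (Fin 2) (Fin 2) ℝ, g.det ≠ 0 → ∀ x,
    F (M * g) x = F M ((√|g.det|)⁻¹ • (g *ᵥ x))
  degenerate : ∀ M, (∃ v ≠ 0, M *ᵥ v = 0) → ∀ x, F M x = 0
  bound : ∀ M, ∫⁻ x, F M x ^ 2 ≤ C

lemma measurePreserving_normalized_mulVec (g : Matrix (Fin 2) (Fin 2) ℝ) (hg : g.det ≠ 0) :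
    MeasurePreserving (fun x : Fin 2 → ℝ => (√|g.det|)⁻¹ • (g *ᵥ x)) volume volume := by
  have h := measurePreserving_mulVec ((√|g.det|)⁻¹ • g) (by
    rw [Matrix.det_smul, Fintype.card_fin, inv_pow, Real.sq_sqrt (abs_nonneg _), abs_mul, abs_inv,
      abs_abs, inv_mul_cancel₀ (abs_ne_zero.2 hg)])
  simpa only [Matrix.smul_mulVec] using h

/-- By equivariance, the `L²` norms need only be bounded on orthonormal pairs. -/
lemma frameFunction_bound_of_orthonormal {F : Matrix (Fin 3) (Fin 2) ℝ → (Fin 2 → ℝ) → ℝ≥0∞} {C : ℝ≥0∞}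
    (hF : Measurable fun p : Matrix (Fin 3) (Fin 2) ℝ × (Fin 2 → ℝ) => F p.1 p.2)
    (hequiv : ∀ M, ∀ g : Matrix (Fin 2) (Fin 2) ℝ, g.det ≠ 0 → ∀ x,
      F (M * g) x = F M ((√|g.det|)⁻¹ • (g *ᵥ x)))
    (hdeg : ∀ M, (∃ v ≠ 0, M *ᵥ v = 0) → ∀ x, F M x = 0)
    (hbound : ∀ W, Wᵀ * W = 1 → ∫⁻ x, F W x ^ 2 ≤ C) (M : Matrix (Fin 3) (Fin 2) ℝ) :
    ∫⁻ x, F M x ^ 2 ≤ C := by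
  by_cases hM : ∃ v ≠ 0, M *ᵥ v = 0
  · simp [hdeg M hM]
  obtain ⟨W, g, hW, hg, rfl⟩ := exists_orthonormal_mul M hM
  simp only [hequiv W g hg]
  have hm : Measurable fun x => F W x ^ 2 := (hF.comp measurable_prodMk_left).pow_const 2
  rw [(measurePreserving_normalized_mulVec g hg).lintegral_comp hm]
  exact hbound W hW

/-- The expectation of a frame function after one random step acting through `c`. The divisor
`512 = 2 ^ 9` is the volume of the cube of noise matrices. -/
noncomputable def averagedFrame (c : Matrix (Fin 3) (Fin 3) ℝ → Matrix (Fin 3) (Fin 3) ℝ)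
    (A : Matrix (Fin 3) (Fin 3) ℝ) (ε : ℝ) (F : Matrix (Fin 3) (Fin 2) ℝ → (Fin 2 → ℝ) → ℝ≥0∞)
    (M : Matrix (Fin 3) (Fin 2) ℝ) (x : Fin 2 → ℝ) : ℝ≥0∞ :=
  (∫⁻ X, F (c (A + ε • X) * M) x ∂boxMeasure 1) / 512

variable {c : Matrix (Fin 3) (Fin 3) ℝ → Matrix (Fin 3) (Fin 3) ℝ}

/-- **One random step contracts** the uniform `L²` bound of frame functions. A proportion `1 / 512`
of the noise can be represented as a noise of half the size followed by one of the identity and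
the two shears, with probability `1 / 3` each; that part contracts by the spectral gap of the shears. -/
lemma FrameFunction.averaged {F : Matrix (Fin 3) (Fin 2) ℝ → (Fin 2 → ℝ) → ℝ≥0∞} {C : ℝ≥0∞}
    (hF : FrameFunction F C) (hc : ShearsFrames c) {A : Matrix (Fin 3) (Fin 3) ℝ} {ε : ℝ} {N : ℕ}
    (hA : ∀ i j, |A i j| ≤ 1) (hε : 0 < ε) (hε1 : ε < 1) (hN : 9 / ε ≤ N) :
    FrameFunction (averagedFrame c A ε F) ((1 - 1 / (147456 * (N : ℝ≥0∞) ^ 2)) * C) := by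
  have hNr : (0 : ℝ) < N := lt_of_lt_of_le (by positivity) hN
  have hN0 : 0 < N := by exact_mod_cast hNr
  have mc : Measurable c := hc.continuous.measurable
  have mstep : ∀ M : Matrix (Fin 3) (Fin 2) ℝ, Measurable fun p : (Fin 2 → ℝ) × Matrix (Fin 3) (Fin 3) ℝ =>
      F (c (A + ε • p.2) * M) p.1 := fun M => by
    have := hc.continuous
    exact hF.measurable.comp
      ((Continuous.measurable (by fun_prop)).prodMk measurable_fst)
  have hmeas : Measurable fun p : Matrix (Fin 3) (Fin 2) ℝ × (Fin 2 → ℝ) =>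
      averagedFrame c A ε F p.1 p.2 := by
    have := hc.continuous
    refine (Measurable.lintegral_prod_right' (ν := boxMeasure 1)
      (f := fun q : (Matrix (Fin 3) (Fin 2) ℝ × (Fin 2 → ℝ)) × Matrix (Fin 3) (Fin 3) ℝ =>
        F (c (A + ε • q.2) * q.1.1) q.1.2) ?_).div_const _
    exact hF.measurable.comp ((Continuous.measurable (by fun_prop)).prodMk
      (measurable_snd.comp measurable_fst))
  have hequiv : ∀ M, ∀ g : Matrix (Fin 2) (Fin 2) ℝ, g.det ≠ 0 → ∀ x,
      averagedFrame c A ε F (M * g) x = averagedFrame c A ε F M ((√|g.det|)⁻¹ • (g *ᵥ x)) := by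
    intro M g hg x
    simp only [averagedFrame, ← Matrix.mul_assoc, hF.equivariant _ g hg]
  have hdeg : ∀ M, (∃ v ≠ 0, M *ᵥ v = 0) → ∀ x, averagedFrame c A ε F M x = 0 := by
    rintro M ⟨v, hv, hMv⟩ x
    have : ∀ X, F (c (A + ε • X) * M) x = 0 := fun X =>
      hF.degenerate _ ⟨v, hv, by rw [← Matrix.mulVec_mulVec, hMv, Matrix.mulVec_zero]⟩ x
    simp [averagedFrame, this]
  refine ⟨hmeas, hequiv, hdeg, frameFunction_bound_of_orthonormal hmeas hequiv hdeg fun W hW => ?_⟩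
  set t : ℝ := 1 / N with ht
  have ht0 : 0 ≤ t := by positivity
  have htε : 9 * t ≤ ε := by
    rw [ht, mul_one_div, div_le_iff₀ hNr]
    rwa [div_le_iff₀ hε, mul_comm] at hN
  obtain ⟨EU, hEU, hdU, hcU⟩ := hc.upper W hW t
  obtain ⟨EL, hEL, hdL, hcL⟩ := hc.lower W hW t
  obtain ⟨τU, mτU, hτU, eU⟩ := exists_noise_change hA hEU hε hε1 ht0 htε hdU
  obtain ⟨τL, mτL, hτL, eL⟩ := exists_noise_change hA hEL hε hε1 ht0 htε hdL
  set β := boxMeasure (1 / 2) with hβ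
  have hβ1 : β ≤ boxMeasure 1 := by
    have := map_boxMeasure_le (r := 1 / 2) (s := 1) (MeasurePreserving.id _)
      (fun X hX i j => (hX i j).trans (by norm_num))
    rwa [Measure.map_id] at this
  have hβu : β Set.univ = 1 := by rw [hβ, boxMeasure_univ]; norm_num
  -- the part of the noise which is a half-size noise followed by a random shear
  set ν : Measure (Matrix (Fin 3) (Fin 3) ℝ) := (3 : ℝ≥0∞)⁻¹ • (β + β.map τU + β.map τL) with hν
  have hν1 : ν ≤ boxMeasure 1 := by
    refine Measure.le_iff.2 fun S hS => ?_
    have a := Measure.le_iff.1 hβ1 S hS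
    have b := Measure.le_iff.1 hτU S hS
    have d := Measure.le_iff.1 hτL S hS
    simp only [hν, Measure.smul_apply, Measure.add_apply, smul_eq_mul]
    rw [← ENNReal.div_eq_inv_mul]
    refine ENNReal.div_le_of_le_mul ?_
    calc _ ≤ boxMeasure 1 S + boxMeasure 1 S + boxMeasure 1 S := by gcongr
      _ = _ := by ring
  have hνu : ν Set.univ = 1 := by
    simp only [hν, Measure.smul_apply, Measure.add_apply, smul_eq_mul,
      Measure.map_apply mτU MeasurableSet.univ, Measure.map_apply mτL MeasurableSet.univ,
      Set.preimage_univ, hβu]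
    rw [show (1 : ℝ≥0∞) + 1 + 1 = 3 by norm_num, ENNReal.inv_mul_cancel (by norm_num) (by norm_num)]
  have : IsFiniteMeasure ν := ⟨by rw [hνu]; simp⟩
  set ρ := boxMeasure 1 - ν with hρ
  have hρν : ρ + ν = boxMeasure 1 := Measure.sub_add_cancel_of_le hν1
  have hρu : ρ Set.univ = 511 := by
    have h : ρ Set.univ + ν Set.univ = boxMeasure 1 Set.univ := by rw [← hρν, Measure.add_apply]
    rw [hνu, boxMeasure_univ] at h
    norm_num at h
    have h2 : ρ Set.univ + 1 = 511 + 1 := by rw [h]; norm_num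
    exact (ENNReal.add_left_inj (by norm_num)).1 h2
  have : IsFiniteMeasure ρ := ⟨by rw [hρu]; simp⟩
  set k : (Fin 2 → ℝ) → ℝ≥0∞ := fun x => ∫⁻ X, F (c (A + ε • X) * W) x ∂β with hk
  have mk : Measurable k := (mstep W).lintegral_prod_right
  have mX : ∀ x, Measurable fun X => F (c (A + ε • X) * W) x := fun x =>
    (mstep W).comp measurable_prodMk_left
  -- the part of the average which is subject to the shears
  have hb : ∀ x, ∫⁻ X, F (c (A + ε • X) * W) x ∂ν
      = (k x + k (upperShear t *ᵥ x) + k (lowerShear t *ᵥ x)) / 3 := by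
    intro x
    have shear : ∀ (g : Matrix (Fin 2) (Fin 2) ℝ) (E : Matrix (Fin 3) (Fin 3) ℝ) (τ : _ → _),
        g.det = 1 → Measurable τ → (∀ X, A + ε • τ X = (A + ε • X) * (1 + t • E)) →
        c (1 + t • E) * W = W * g →
        ∫⁻ X, F (c (A + ε • X) * W) x ∂(β.map τ) = k (g *ᵥ x) := by
      intro g E τ hg mτ hτ hE
      rw [lintegral_map (mX x) mτ]
      refine lintegral_congr fun X => ?_
      rw [hτ, hc.map_mul, Matrix.mul_assoc, hE, ← Matrix.mul_assoc,
        hF.equivariant _ g (by rw [hg]; exact one_ne_zero), hg]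
      simp
    rw [hν, lintegral_smul_measure, lintegral_add_measure, lintegral_add_measure,
      shear _ _ _ (det_upperShear t) mτU eU hcU, shear _ _ _ (det_lowerShear t) mτL eL hcL,
      smul_eq_mul, ENNReal.div_eq_inv_mul]
  have hfub : ∀ (σ : Measure (Matrix (Fin 3) (Fin 3) ℝ)) [IsFiniteMeasure σ],
      ∫⁻ x, (∫⁻ X, F (c (A + ε • X) * W) x ∂σ) ^ 2 ≤ σ Set.univ * (σ Set.univ * C) := by
    intro σ _
    calc ∫⁻ x, (∫⁻ X, F (c (A + ε • X) * W) x ∂σ) ^ 2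
        ≤ ∫⁻ x, σ Set.univ * ∫⁻ X, F (c (A + ε • X) * W) x ^ 2 ∂σ :=
          lintegral_mono fun x => lintegral_sq_le σ (mX x).aemeasurable
      _ = σ Set.univ * ∫⁻ x, (∫⁻ X, F (c (A + ε • X) * W) x ^ 2 ∂σ) :=
          lintegral_const_mul _ ((mstep W).pow_const 2).lintegral_prod_right
      _ = σ Set.univ * ∫⁻ X, (∫⁻ x, F (c (A + ε • X) * W) x ^ 2) ∂σ := by
          rw [lintegral_lintegral_swap ((mstep W).pow_const 2).aemeasurable]
      _ ≤ σ Set.univ * ∫⁻ X, C ∂σ := by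
          gcongr with X
          exact hF.bound _
      _ = _ := by rw [lintegral_const, mul_comm C]
  have hkC : ∫⁻ x, k x ^ 2 ≤ C := by simpa [hβu] using hfub β
  set η : ℝ≥0∞ := 1 / (288 * (N : ℝ≥0∞) ^ 2) with hη
  have ma : Measurable fun x => ∫⁻ X, F (c (A + ε • X) * W) x ∂ρ := (mstep W).lintegral_prod_right
  calc ∫⁻ x, averagedFrame c A ε F W x ^ 2
      = ∫⁻ x, ((∫⁻ X, F (c (A + ε • X) * W) x ∂ρ + ∫⁻ X, F (c (A + ε • X) * W) x ∂ν) / 512) ^ 2 := by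
        simp only [averagedFrame, ← hρν, lintegral_add_measure]
    _ ≤ ∫⁻ x, ((∫⁻ X, F (c (A + ε • X) * W) x ∂ρ) ^ 2 / 511
          + ((k x + k (upperShear t *ᵥ x) + k (lowerShear t *ᵥ x)) / 3) ^ 2) / 512 := by
        gcongr with x
        rw [hb x]
        exact div_sq_le_of_masses _ _
    _ = ((∫⁻ x, (∫⁻ X, F (c (A + ε • X) * W) x ∂ρ) ^ 2) / 511
          + ∫⁻ x, ((k x + k (upperShear t *ᵥ x) + k (lowerShear t *ᵥ x)) / 3) ^ 2) / 512 := by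
        simp only [div_eq_mul_inv _ (512 : ℝ≥0∞), div_eq_mul_inv _ (511 : ℝ≥0∞)]
        rw [lintegral_mul_const' _ _ (by simp), lintegral_add_left ((ma.pow_const 2).mul_const _),
          lintegral_mul_const' _ _ (by simp)]
    _ ≤ (511 * (511 * C) / 511 + (1 - η) * C) / 512 := by
        gcongr
        · have := hfub ρ
          rwa [hρu] at this
        · exact (lintegral_sq_average_shears_le k mk hN0).trans (by gcongr)
    _ = (511 + (1 - η)) / 512 * C := by
        rw [mul_comm (511 : ℝ≥0∞) (511 * C), ENNReal.mul_div_cancel_right (by norm_num) (by norm_num),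
          ← add_mul]
        simp only [div_eq_mul_inv]; ring
    _ = (1 - 1 / (147456 * (N : ℝ≥0∞) ^ 2)) * C := by
        congr 1
        have hη1 : η ≤ 1 := by
          rw [hη, one_div, ENNReal.inv_le_one]
          have : (1 : ℝ≥0∞) ≤ (N : ℝ≥0∞) ^ 2 := by exact_mod_cast Nat.one_le_pow _ _ hN0
          calc (1 : ℝ≥0∞) ≤ 288 * 1 := by norm_num
            _ ≤ _ := by gcongr
        have hη512 : 1 / (147456 * (N : ℝ≥0∞) ^ 2) = η / 512 := by
          rw [hη, one_div, one_div, div_eq_mul_inv, ← ENNReal.mul_inv (by simp) (by simp)]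
          congr 1; ring
        rw [hη512]
        refine ENNReal.eq_sub_of_add_eq
          (ENNReal.div_ne_top (ne_top_of_le_ne_top ENNReal.one_ne_top hη1) (by norm_num)) ?_
        rw [← ENNReal.add_div, add_assoc, tsub_add_cancel_of_le hη1,
          show (511 : ℝ≥0∞) + 1 = 512 by norm_num, ENNReal.div_self (by norm_num) (by norm_num)]

/-! ### The law of the noise -/

/-- The uniform distribution on `3 × 3` matrices with entries in `[-1, 1]`. -/
noncomputable def noiseLaw : Measure (Matrix (Fin 3) (Fin 3) ℝ) := (512 : ℝ≥0∞)⁻¹ • boxMeasure 1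

instance : IsProbabilityMeasure noiseLaw := ⟨by
  rw [noiseLaw, Measure.smul_apply, boxMeasure_univ, smul_eq_mul]
  norm_num
  exact ENNReal.inv_mul_cancel (by norm_num) (by norm_num)⟩

lemma lintegral_noiseLaw (f : Matrix (Fin 3) (Fin 3) ℝ → ℝ≥0∞) :
    ∫⁻ X, f X ∂noiseLaw = (∫⁻ X, f X ∂boxMeasure 1) / 512 := by
  rw [noiseLaw, lintegral_smul_measure, smul_eq_mul, ENNReal.div_eq_inv_mul]

lemma pi_const_smul {ι α : Type*} [Fintype ι] [MeasurableSpace α] (a : ℝ≥0∞) (ha : a ≠ ∞) (m : Measure α)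
    [IsFiniteMeasure m] :
    Measure.pi (fun _ : ι => a • m) = a ^ Fintype.card ι • Measure.pi fun _ : ι => m := by
  have : IsFiniteMeasure (a • m) := m.smul_finite ha
  refine Measure.pi_eq fun s hs => ?_
  simp [Measure.pi_pi, Finset.prod_mul_distrib]

/-- The uniform distribution on the interval `[-1, 1]`. -/
noncomputable abbrev uniformLaw : Measure ℝ := ProbabilityTheory.cond volume (Set.Icc (-1 : ℝ) 1)

lemma uniformLaw_eq : uniformLaw = (2 : ℝ≥0∞)⁻¹ • volume.restrict (Set.Icc (-1 : ℝ) 1) := by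
  rw [uniformLaw, ProbabilityTheory.cond, Real.volume_Icc]
  norm_num

instance : IsProbabilityMeasure uniformLaw :=
  ProbabilityTheory.cond_isProbabilityMeasure_of_finite (by rw [Real.volume_Icc]; norm_num)
    (by rw [Real.volume_Icc]; norm_num)

lemma noiseLaw_eq_pi :
    noiseLaw = Measure.pi fun _ : Fin 3 => Measure.pi fun _ : Fin 3 => uniformLaw := by
  have h1 : (fun _ : Fin 3 => Measure.pi fun _ : Fin 3 => uniformLaw)
      = fun _ => (8 : ℝ≥0∞)⁻¹ • Measure.pi fun _ : Fin 3 => volume.restrict (Set.Icc (-1 : ℝ) 1) := by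
    funext _
    rw [uniformLaw_eq, pi_const_smul _ (by simp)]
    congr 1
    rw [Fintype.card_fin, ← ENNReal.inv_pow]
    norm_num
  rw [h1, pi_const_smul _ (by simp), noiseLaw, Fintype.card_fin, ← ENNReal.inv_pow]
  have h2 : boxMeasure 1 = Measure.pi fun _ : Fin 3 => Measure.pi fun _ : Fin 3 =>
      volume.restrict (Set.Icc (-1 : ℝ) 1) := by
    rw [← Measure.restrict_pi_pi, ← Measure.restrict_pi_pi, ← box_eq_pi]
    rfl
  rw [h2]
  norm_num
  rfl

section Noise

variable {Ω : Type*} [MeasurableSpace Ω] {μ : Measure Ω}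
  {Ξ : ℕ → Ω → Matrix (Fin 3) (Fin 3) ℝ}

lemma IsUniformNoise.measurable (h : IsUniformNoise μ Ξ) (n : ℕ) : Measurable (Ξ n) :=
  measurable_pi_lambda _ fun a => measurable_pi_lambda _ fun b => h.measurable_entry n a b

lemma IsUniformNoise.map_eq_infinitePi [IsProbabilityMeasure μ] (h : IsUniformNoise μ Ξ) :
    μ.map (fun ω n => Ξ n ω) = Measure.infinitePi fun _ => noiseLaw := by
  have h1 := (iIndepFun_iff_map_fun_eq_infinitePi_map
    (fun p : ℕ × Fin 3 × Fin 3 => h.measurable_entry p.1 p.2.1 p.2.2)).1 h.independent_entries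
  have h2 : (fun p : ℕ × Fin 3 × Fin 3 => μ.map fun ω => Ξ p.1 ω p.2.1 p.2.2) = fun _ => uniformLaw :=
    funext fun p => h.uniform_entry p.1 p.2.1 p.2.2
  rw [h2] at h1
  have h3 := Measure.infinitePi_map_curry (ι := ℕ) (κ := Fin 3 × Fin 3) fun _ _ => uniformLaw
  have h4 := Measure.infinitePi_map_curry (ι := Fin 3) (κ := Fin 3) fun _ _ => uniformLaw
  have h5 := Measure.infinitePi_map_pi (ι := ℕ)
    (μ := fun _ => Measure.infinitePi fun _ : Fin 3 × Fin 3 => uniformLaw)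
    (f := fun _ => MeasurableEquiv.curry (Fin 3) (Fin 3) ℝ) (fun _ => MeasurableEquiv.measurable _)
  simp only [h4] at h5
  rw [← h3, Measure.map_map (by fun_prop) (by fun_prop), ← h1,
    Measure.map_map (f := fun ω (p : ℕ × Fin 3 × Fin 3) => Ξ p.1 ω p.2.1 p.2.2) (by fun_prop)
      (measurable_pi_lambda _ fun p => h.measurable_entry p.1 p.2.1 p.2.2)] at h5
  simp only [Measure.infinitePi_eq_pi, ← noiseLaw_eq_pi] at h5
  exact h5

lemma IsUniformNoise.map_eq [IsProbabilityMeasure μ] (h : IsUniformNoise μ Ξ) (n : ℕ) :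
    μ.map (Ξ n) = noiseLaw := by
  have h1 := Measure.infinitePi_map_eval (fun _ : ℕ => noiseLaw) n
  rw [← h.map_eq_infinitePi, Measure.map_map (by fun_prop)
    (measurable_pi_lambda _ h.measurable)] at h1
  exact h1

lemma IsUniformNoise.iIndepFun [IsProbabilityMeasure μ] (h : IsUniformNoise μ Ξ) :
    ProbabilityTheory.iIndepFun Ξ μ := by
  rw [iIndepFun_iff_map_fun_eq_infinitePi_map h.measurable, h.map_eq_infinitePi]
  simp only [h.map_eq]

lemma continuous_perturbedProduct_step (A : Matrix (Fin 3) (Fin 3) ℝ) (ε : ℝ) :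
    Continuous fun p : Matrix (Fin 3) (Fin 3) ℝ × Matrix (Fin 3) (Fin 3) ℝ => (A + ε • p.2) * p.1 := by
  fun_prop

/-- The product of the first `n` perturbed matrices is a measurable function of the first `n` noise
matrices. -/
lemma exists_measurable_perturbedProduct (ε : ℝ) (A : ℕ → Matrix (Fin 3) (Fin 3) ℝ) (n : ℕ) :
    ∃ f : (Finset.range n → Matrix (Fin 3) (Fin 3) ℝ) → Matrix (Fin 3) (Fin 3) ℝ, Measurable f ∧
      ∀ X : ℕ → Matrix (Fin 3) (Fin 3) ℝ, perturbedProduct ε A X n = f fun i => X i := by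
  induction n with
  | zero => exact ⟨fun _ => 1, measurable_const, fun _ => rfl⟩
  | succ n ih =>
    obtain ⟨f, hf, hfX⟩ := ih
    refine ⟨fun Y => (A n + ε • Y ⟨n, by simp⟩)
      * f fun i => Y ⟨i, Finset.mem_range.2 ((Finset.mem_range.1 i.2).trans n.lt_succ_self)⟩, ?_, ?_⟩
    · refine (continuous_perturbedProduct_step (A n) ε).measurable.comp (Measurable.prodMk ?_ ?_)
      · exact hf.comp (measurable_pi_lambda _ fun i => measurable_pi_apply _)
      · exact measurable_pi_apply _
    · intro X
      rw [perturbedProduct, hfX]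

lemma measurable_perturbedProduct (h : IsUniformNoise μ Ξ) (ε : ℝ)
    (A : ℕ → Matrix (Fin 3) (Fin 3) ℝ) (n : ℕ) :
    Measurable fun ω => perturbedProduct ε A (fun k => Ξ k ω) n := by
  obtain ⟨f, hf, hfX⟩ := exists_measurable_perturbedProduct ε A n
  simp only [hfX]
  exact hf.comp (measurable_pi_lambda _ fun i => h.measurable i)

/-- Conditioning on the first `n` steps: the next noise matrix may be integrated out first. -/
lemma lintegral_perturbedProduct_noise [IsProbabilityMeasure μ] (h : IsUniformNoise μ Ξ) (ε : ℝ)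
    (A : ℕ → Matrix (Fin 3) (Fin 3) ℝ) (n : ℕ)
    {G : Matrix (Fin 3) (Fin 3) ℝ × Matrix (Fin 3) (Fin 3) ℝ → ℝ≥0∞} (hG : Measurable G) :
    ∫⁻ ω, G (perturbedProduct ε A (fun k => Ξ k ω) n, Ξ n ω) ∂μ
      = ∫⁻ ω, ∫⁻ X, G (perturbedProduct ε A (fun k => Ξ k ω) n, X) ∂noiseLaw ∂μ := by
  obtain ⟨f, hf, hfX⟩ := exists_measurable_perturbedProduct ε A n
  have hind := h.iIndepFun.indepFun_finset (Finset.range n) {n} (by simp) h.measurable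
  have hind2 : IndepFun (fun ω => perturbedProduct ε A (fun k => Ξ k ω) n) (Ξ n) μ := by
    have := hind.comp hf (measurable_pi_apply (⟨n, by simp⟩ : ({n} : Finset ℕ)))
    simp only [hfX]
    exact this
  have hm := measurable_perturbedProduct h ε A n
  have hprod := hind2.map_prod_eq_prod_map_map hm.aemeasurable (h.measurable n).aemeasurable
  rw [h.map_eq] at hprod
  rw [← lintegral_map hG (hm.prodMk (h.measurable n)), hprod, lintegral_prod _ hG.aemeasurable,
    lintegral_map hG.lintegral_prod_right' hm]

end Noise

/-! ### Exponential decay of the expected eccentricity -/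

/-- The squared Frobenius norm. -/
def frobSq {m n : Type*} [Fintype m] [Fintype n] (M : Matrix m n ℝ) : ℝ := ∑ i, ∑ j, M i j ^ 2

lemma frobSq_nonneg {m n : Type*} [Fintype m] [Fintype n] (M : Matrix m n ℝ) : 0 ≤ frobSq M :=
  Finset.sum_nonneg fun _ _ => Finset.sum_nonneg fun _ _ => sq_nonneg _

/-- The squared area of the parallelogram spanned by two vectors. -/
def areaSq (M : Matrix (Fin 3) (Fin 2) ℝ) : ℝ := (Mᵀ * M).det

lemma areaSq_eq (M : Matrix (Fin 3) (Fin 2) ℝ) :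
    areaSq M = (M 1 0 * M 2 1 - M 2 0 * M 1 1) ^ 2 + (M 0 0 * M 2 1 - M 2 0 * M 0 1) ^ 2
      + (M 0 0 * M 1 1 - M 1 0 * M 0 1) ^ 2 := by
  rw [areaSq, Matrix.det_fin_two]
  simp [Matrix.mul_apply, Fin.sum_univ_three]
  ring

lemma areaSq_nonneg (M : Matrix (Fin 3) (Fin 2) ℝ) : 0 ≤ areaSq M := by
  rw [areaSq_eq]; positivity

lemma areaSq_mul (M : Matrix (Fin 3) (Fin 2) ℝ) (g : Matrix (Fin 2) (Fin 2) ℝ) :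
    areaSq (M * g) = g.det ^ 2 * areaSq M := by
  rw [areaSq, areaSq, Matrix.transpose_mul, Matrix.mul_assoc, ← Matrix.mul_assoc Mᵀ, Matrix.det_mul,
    Matrix.det_mul, Matrix.det_transpose]
  ring

lemma areaSq_eq_zero_of_kernel {M : Matrix (Fin 3) (Fin 2) ℝ} (h : ∃ v ≠ 0, M *ᵥ v = 0) :
    areaSq M = 0 := by
  obtain ⟨v, hv, hMv⟩ := h
  exact Matrix.exists_mulVec_eq_zero_iff.1 ⟨v, hv, by rw [← Matrix.mulVec_mulVec, hMv, Matrix.mulVec_zero]⟩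

/-- The ratio of area to squared size of a pair of vectors, which is comparable with the ratio of
the smaller to the larger singular value. -/
noncomputable def eccentricity (M : Matrix (Fin 3) (Fin 2) ℝ) : ℝ := √(areaSq M) / frobSq M

lemma eccentricity_nonneg (M : Matrix (Fin 3) (Fin 2) ℝ) : 0 ≤ eccentricity M :=
  div_nonneg (Real.sqrt_nonneg _) (frobSq_nonneg _)

lemma continuous_frobSq {m n : Type*} [Fintype m] [Fintype n] :
    Continuous (frobSq : Matrix m n ℝ → ℝ) := by unfold frobSq; fun_prop

lemma continuous_areaSq : Continuous areaSq := by unfold areaSq; fun_prop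

lemma measurable_eccentricity : Measurable eccentricity :=
  (continuous_areaSq.sqrt.measurable).div continuous_frobSq.measurable

lemma two_mul_sqrt_areaSq_le (M : Matrix (Fin 3) (Fin 2) ℝ) : 2 * √(areaSq M) ≤ frobSq M := by
  have h : √(areaSq M) ≤ frobSq M / 2 := by
    refine Real.sqrt_le_iff.2 ⟨by have := frobSq_nonneg M; positivity, ?_⟩
    rw [areaSq_eq]
    simp only [frobSq, Fin.sum_univ_three, Fin.sum_univ_two]
    nlinarith [sq_nonneg (M 0 0 ^ 2 + M 1 0 ^ 2 + M 2 0 ^ 2 - (M 0 1 ^ 2 + M 1 1 ^ 2 + M 2 1 ^ 2)),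
      sq_nonneg (M 0 0 * M 0 1 + M 1 0 * M 1 1 + M 2 0 * M 2 1)]
  linarith

lemma dotProduct_mulVec_self_le (M : Matrix (Fin 3) (Fin 2) ℝ) (x : Fin 2 → ℝ) :
    (M *ᵥ x) ⬝ᵥ (M *ᵥ x) ≤ frobSq M * (x 0 ^ 2 + x 1 ^ 2) := by
  have h : ∀ i, (M *ᵥ x) i * (M *ᵥ x) i ≤ (M i 0 ^ 2 + M i 1 ^ 2) * (x 0 ^ 2 + x 1 ^ 2) := by
    intro i
    simp only [Matrix.mulVec, dotProduct, Fin.sum_univ_two]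
    nlinarith [sq_nonneg (M i 0 * x 1 - M i 1 * x 0)]
  calc _ = ∑ i, (M *ᵥ x) i * (M *ᵥ x) i := rfl
    _ ≤ ∑ i, (M i 0 ^ 2 + M i 1 ^ 2) * (x 0 ^ 2 + x 1 ^ 2) := Finset.sum_le_sum fun i _ => h i
    _ = _ := by simp only [frobSq, ← Finset.sum_mul, Fin.sum_univ_two]

/-- The indicator of the unit disc in the plane spanned by `M`, in the coordinates given by `M` after
normalisation of area. It vanishes if the two columns of `M` are dependent. -/
noncomputable def discFrame (M : Matrix (Fin 3) (Fin 2) ℝ) (x : Fin 2 → ℝ) : ℝ≥0∞ :=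
  {p : Matrix (Fin 3) (Fin 2) ℝ × (Fin 2 → ℝ) |
    areaSq p.1 ≠ 0 ∧ (p.1 *ᵥ p.2) ⬝ᵥ (p.1 *ᵥ p.2) ≤ √(areaSq p.1)}.indicator 1 (M, x)

lemma frameFunction_discFrame : FrameFunction discFrame 4 := by
  have hmeas : Measurable fun p : Matrix (Fin 3) (Fin 2) ℝ × (Fin 2 → ℝ) => discFrame p.1 p.2 := by
    refine measurable_one.indicator (MeasurableSet.inter ?_ ?_)
    · exact ((continuous_areaSq.comp continuous_fst).measurable (measurableSet_singleton 0)).compl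
    · have h1 : Continuous fun p : Matrix (Fin 3) (Fin 2) ℝ × (Fin 2 → ℝ) =>
          (p.1 *ᵥ p.2) ⬝ᵥ (p.1 *ᵥ p.2) := by fun_prop
      have h2 : Continuous fun p : Matrix (Fin 3) (Fin 2) ℝ × (Fin 2 → ℝ) => √(areaSq p.1) :=
        (continuous_areaSq.comp continuous_fst).sqrt
      exact measurableSet_le h1.measurable h2.measurable
  have hequiv : ∀ M, ∀ g : Matrix (Fin 2) (Fin 2) ℝ, g.det ≠ 0 → ∀ x,
      discFrame (M * g) x = discFrame M ((√|g.det|)⁻¹ • (g *ᵥ x)) := by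
    intro M g hg x
    have hd : 0 < |g.det| := abs_pos.2 hg
    have h : ((M * g, x) ∈ {p : Matrix (Fin 3) (Fin 2) ℝ × (Fin 2 → ℝ) |
        areaSq p.1 ≠ 0 ∧ (p.1 *ᵥ p.2) ⬝ᵥ (p.1 *ᵥ p.2) ≤ √(areaSq p.1)})
        ↔ ((M, (√|g.det|)⁻¹ • (g *ᵥ x)) ∈ {p : Matrix (Fin 3) (Fin 2) ℝ × (Fin 2 → ℝ) |
        areaSq p.1 ≠ 0 ∧ (p.1 *ᵥ p.2) ⬝ᵥ (p.1 *ᵥ p.2) ≤ √(areaSq p.1)}) := by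
      simp only [Set.mem_ofPred_eq, areaSq_mul, Matrix.mulVec_smul, smul_dotProduct, dotProduct_smul,
        smul_eq_mul, Matrix.mulVec_mulVec]
      refine and_congr (by simp [hg]) ?_
      rw [← mul_assoc, ← sq, inv_pow, Real.sq_sqrt hd.le, inv_mul_le_iff₀ hd,
        Real.sqrt_mul (sq_nonneg _), Real.sqrt_sq_eq_abs]
    by_cases h1 : (M * g, x) ∈ {p : Matrix (Fin 3) (Fin 2) ℝ × (Fin 2 → ℝ) |
        areaSq p.1 ≠ 0 ∧ (p.1 *ᵥ p.2) ⬝ᵥ (p.1 *ᵥ p.2) ≤ √(areaSq p.1)}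
    · rw [discFrame, discFrame, Set.indicator_of_mem h1, Set.indicator_of_mem (h.1 h1)]; rfl
    · rw [discFrame, discFrame, Set.indicator_of_notMem h1, Set.indicator_of_notMem fun h2 => h1 (h.2 h2)]
  have hdeg : ∀ M, (∃ v ≠ 0, M *ᵥ v = 0) → ∀ x, discFrame M x = 0 := by
    intro M hM x
    exact Set.indicator_of_notMem (fun h => h.1 (areaSq_eq_zero_of_kernel hM)) _
  refine ⟨hmeas, hequiv, hdeg, frameFunction_bound_of_orthonormal hmeas hequiv hdeg fun W hW => ?_⟩
  calc ∫⁻ x, discFrame W x ^ 2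
      ≤ ∫⁻ x, (Set.univ.pi fun _ : Fin 2 => Set.Icc (-1 : ℝ) 1).indicator 1 x := by
        refine lintegral_mono fun x => ?_
        by_cases hx : (W, x) ∈ {p : Matrix (Fin 3) (Fin 2) ℝ × (Fin 2 → ℝ) |
            areaSq p.1 ≠ 0 ∧ (p.1 *ᵥ p.2) ⬝ᵥ (p.1 *ᵥ p.2) ≤ √(areaSq p.1)}
        · have h1 : (W *ᵥ x) ⬝ᵥ (W *ᵥ x) = x 0 ^ 2 + x 1 ^ 2 := by
            rw [Matrix.dotProduct_mulVec, Matrix.vecMul_mulVec, hW, Matrix.vecMul_one]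
            simp [dotProduct, Fin.sum_univ_two, sq]
          have h2 := hx.2
          simp only [h1, areaSq, hW, Matrix.det_one, Real.sqrt_one] at h2
          rw [discFrame, Set.indicator_of_mem hx, Set.indicator_of_mem]
          · simp
          · intro i _
            rw [Set.mem_Icc, ← abs_le, ← sq_le_one_iff_abs_le_one]
            have h3 : ∀ i : Fin 2, x i ^ 2 ≤ 1 := Fin.forall_fin_two.2
              ⟨by linarith [sq_nonneg (x 1)], by linarith [sq_nonneg (x 0)]⟩
            exact h3 i
        · rw [discFrame, Set.indicator_of_notMem hx]; simp
    _ = 4 := by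
        rw [lintegral_indicator_one (MeasurableSet.univ_pi fun _ => measurableSet_Icc), volume_pi_pi]
        norm_num [Real.volume_Icc]

/-- The mass of the disc of `M` in the unit square controls the eccentricity of `M`. -/
lemma ofReal_two_mul_eccentricity_le (M : Matrix (Fin 3) (Fin 2) ℝ) :
    ENNReal.ofReal (2 * eccentricity M)
      ≤ ∫⁻ x in Set.univ.pi fun _ : Fin 2 => Set.Icc (-1 : ℝ) 1, discFrame M x := by
  by_cases h0 : areaSq M = 0
  · simp [eccentricity, h0]
  have ha : 0 < √(areaSq M) := Real.sqrt_pos.2 (lt_of_le_of_ne (areaSq_nonneg M) (Ne.symm h0))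
  have hf : 0 < frobSq M := by have := two_mul_sqrt_areaSq_le M; linarith
  rw [eccentricity]
  set r := √(areaSq M) / frobSq M with hr
  have hr0 : 0 < r := by positivity
  have hr1 : r ≤ 1 / 2 := by
    rw [hr, div_le_div_iff₀ hf (by norm_num)]; have := two_mul_sqrt_areaSq_le M; linarith
  -- the square of half-side `h` with `2 h² = r` lies in the disc of `M` and in the unit square
  set h := √(r / 2) with hh
  have hh0 : 0 ≤ h := Real.sqrt_nonneg _
  have hh2 : h ^ 2 = r / 2 := Real.sq_sqrt (by positivity)
  have hh1 : h ≤ 1 := by nlinarith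
  have hsub : (Set.univ.pi fun _ : Fin 2 => Set.Icc (-h) h)
      ⊆ Set.univ.pi fun _ : Fin 2 => Set.Icc (-1 : ℝ) 1 :=
    Set.pi_mono fun _ _ => Set.Icc_subset_Icc (by linarith) hh1
  calc ENNReal.ofReal (2 * r) = volume (Set.univ.pi fun _ : Fin 2 => Set.Icc (-h) h) := by
        rw [volume_pi_pi]
        simp only [Real.volume_Icc, Finset.prod_const, Finset.card_univ, Fintype.card_fin]
        rw [← ENNReal.ofReal_pow (by linarith)]
        congr 1
        nlinarith
    _ = ∫⁻ x in Set.univ.pi fun _ : Fin 2 => Set.Icc (-h) h, 1 := by simp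
    _ ≤ ∫⁻ x in Set.univ.pi fun _ : Fin 2 => Set.Icc (-h) h, discFrame M x := by
        refine setLIntegral_mono' (MeasurableSet.univ_pi fun _ => measurableSet_Icc) fun x hx => ?_
        rw [discFrame, Set.indicator_of_mem]
        · rfl
        refine ⟨h0, (dotProduct_mulVec_self_le M x).trans ?_⟩
        have hb : ∀ i, x i ^ 2 ≤ r / 2 := fun i => by
          rw [← hh2, sq_le_sq, abs_of_nonneg hh0, abs_le]
          exact hx i (Set.mem_univ i)
        calc frobSq M * (x 0 ^ 2 + x 1 ^ 2) ≤ frobSq M * (r / 2 + r / 2) := by gcongr <;> exact hb _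
          _ = √(areaSq M) := by rw [hr]; field_simp; ring
    _ ≤ _ := lintegral_mono_set hsub

/-- The expectation over the first `n` steps of a function of the frame. -/
noncomputable def iteratedFrame (c : Matrix (Fin 3) (Fin 3) ℝ → Matrix (Fin 3) (Fin 3) ℝ)
    (A : ℕ → Matrix (Fin 3) (Fin 3) ℝ) (ε : ℝ) :
    ℕ → (Matrix (Fin 3) (Fin 2) ℝ → (Fin 2 → ℝ) → ℝ≥0∞) →
      Matrix (Fin 3) (Fin 2) ℝ → (Fin 2 → ℝ) → ℝ≥0∞
  | 0, F => F
  | n + 1, F => iteratedFrame c A ε n (averagedFrame c (A n) ε F)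

section

variable {c : Matrix (Fin 3) (Fin 3) ℝ → Matrix (Fin 3) (Fin 3) ℝ}
  {A : ℕ → Matrix (Fin 3) (Fin 3) ℝ} {ε : ℝ} {N : ℕ}

lemma FrameFunction.iterated (hc : ShearsFrames c) (hA : ∀ n i j, |A n i j| ≤ 1) (hε : 0 < ε)
    (hε1 : ε < 1) (hN : 9 / ε ≤ N) (n : ℕ) {F : Matrix (Fin 3) (Fin 2) ℝ → (Fin 2 → ℝ) → ℝ≥0∞}
    {C : ℝ≥0∞} (hF : FrameFunction F C) :
    FrameFunction (iteratedFrame c A ε n F) ((1 - 1 / (147456 * (N : ℝ≥0∞) ^ 2)) ^ n * C) := by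
  induction n generalizing F C with
  | zero => simpa [iteratedFrame] using hF
  | succ n ih =>
    have := ih (hF.averaged hc (hA n) hε hε1 hN)
    rwa [← mul_assoc, ← pow_succ] at this

variable {Ω : Type*} [MeasurableSpace Ω] {μ : Measure Ω} [IsProbabilityMeasure μ]
  {Ξ : ℕ → Ω → Matrix (Fin 3) (Fin 3) ℝ}

/-- The Markov property: averaging one step at a time computes the expectation over the product. -/
lemma lintegral_frame_perturbedProduct (h : IsUniformNoise μ Ξ) (hc : ShearsFrames c)
    (hc1 : c 1 = 1) (hA : ∀ n i j, |A n i j| ≤ 1) (hε : 0 < ε) (hε1 : ε < 1) (hN : 9 / ε ≤ N) (n : ℕ)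
    {F : Matrix (Fin 3) (Fin 2) ℝ → (Fin 2 → ℝ) → ℝ≥0∞} {C : ℝ≥0∞} (hF : FrameFunction F C)
    (M : Matrix (Fin 3) (Fin 2) ℝ) (x : Fin 2 → ℝ) :
    ∫⁻ ω, F (c (perturbedProduct ε A (fun k => Ξ k ω) n) * M) x ∂μ = iteratedFrame c A ε n F M x := by
  induction n generalizing F C with
  | zero => simp [perturbedProduct, iteratedFrame, hc1]
  | succ n ih =>
    have hcc := hc.continuous
    rw [iteratedFrame, ← ih (hF.averaged hc (hA n) hε hε1 hN)]
    have hG : Measurable fun p : Matrix (Fin 3) (Fin 3) ℝ × Matrix (Fin 3) (Fin 3) ℝ =>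
        F (c ((A n + ε • p.2) * p.1) * M) x := by
      exact hF.measurable.comp ((Continuous.measurable (by fun_prop)).prodMk measurable_const)
    have := lintegral_perturbedProduct_noise h ε A n hG
    simp only [perturbedProduct]
    rw [this]
    refine lintegral_congr fun ω => ?_
    rw [lintegral_noiseLaw, averagedFrame]
    simp only [hc.map_mul, Matrix.mul_assoc]

/-- The rate of contraction obtained from the spectral gap for shears of size `1 / N`. The constant is
`147456 = 288 * 512`, the product of those of the spectral gap and of the volume of the noise cube. -/
noncomputable def contractionRate (N : ℕ) : ℝ := √(1 - 1 / (147456 * (N : ℝ) ^ 2))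

lemma contractionRate_sq (hN : 0 < N) :
    ENNReal.ofReal (contractionRate N) ^ 2 = 1 - 1 / (147456 * (N : ℝ≥0∞) ^ 2) := by
  have h1 : (1 : ℝ) ≤ (N : ℝ) ^ 2 := by exact_mod_cast Nat.one_le_pow _ _ hN
  have h2 : 1 / (147456 * (N : ℝ) ^ 2) ≤ 1 := by
    rw [div_le_one (by positivity)]; linarith
  rw [contractionRate, ← ENNReal.ofReal_pow (Real.sqrt_nonneg _), Real.sq_sqrt (by linarith),
    ENNReal.ofReal_sub _ (by positivity), ENNReal.ofReal_div_of_pos (by positivity),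
    ENNReal.ofReal_mul (by norm_num), ENNReal.ofReal_pow (by positivity)]
  simp

lemma FrameFunction.measurable_comp {F : Matrix (Fin 3) (Fin 2) ℝ → (Fin 2 → ℝ) → ℝ≥0∞} {C : ℝ≥0∞}
    (hF : FrameFunction F C) {K : Ω → Matrix (Fin 3) (Fin 2) ℝ} (mK : Measurable K) :
    Measurable fun p : Ω × (Fin 2 → ℝ) => F (K p.1) p.2 :=
  have hK : Measurable fun p : Ω × (Fin 2 → ℝ) => (K p.1, p.2) :=
    (mK.comp measurable_fst).prodMk measurable_snd
  hF.measurable.comp hK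

/-- The mean eccentricity of a random pair of vectors is controlled by the mean disc frame. -/
lemma sq_lintegral_eccentricity_le {K : Ω → Matrix (Fin 3) (Fin 2) ℝ} (mK : Measurable K) :
    (∫⁻ ω, ENNReal.ofReal (2 * eccentricity (K ω)) ∂μ) ^ 2
      ≤ 4 * ∫⁻ x, (∫⁻ ω, discFrame (K ω) x ∂μ) ^ 2 := by
  have hm := frameFunction_discFrame.measurable_comp mK
  have hQv : volume (Set.univ.pi fun _ : Fin 2 => Set.Icc (-1 : ℝ) 1) = 4 := by
    simp only [volume_pi_pi, Real.volume_Icc, Finset.prod_const, Finset.card_univ, Fintype.card_fin]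
    norm_num
  have h1 : ∫⁻ ω, ENNReal.ofReal (2 * eccentricity (K ω)) ∂μ
      ≤ ∫⁻ x in Set.univ.pi fun _ : Fin 2 => Set.Icc (-1 : ℝ) 1, ∫⁻ ω, discFrame (K ω) x ∂μ := by
    calc _ ≤ ∫⁻ ω, (∫⁻ x in Set.univ.pi fun _ : Fin 2 => Set.Icc (-1 : ℝ) 1, discFrame (K ω) x) ∂μ :=
          lintegral_mono fun ω => ofReal_two_mul_eccentricity_le (K ω)
      _ = _ := lintegral_lintegral_swap hm.aemeasurable
  have hm2 : Measurable fun x => ∫⁻ ω, discFrame (K ω) x ∂μ := hm.lintegral_prod_left'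
  calc _ ≤ _ := pow_le_pow_left' h1 2
    _ ≤ _ := lintegral_sq_le _ hm2.aemeasurable
    _ ≤ _ := by
        rw [Measure.restrict_apply_univ, hQv]
        gcongr
        exact Measure.restrict_le_self

/-- The expected eccentricity of the image of a fixed pair of vectors decays exponentially. -/
lemma lintegral_eccentricity_le (h : IsUniformNoise μ Ξ) (hc : ShearsFrames c) (hc1 : c 1 = 1)
    (hA : ∀ n i j, |A n i j| ≤ 1) (hε : 0 < ε) (hε1 : ε < 1) (hN : 9 / ε ≤ N) (n : ℕ)
    (M : Matrix (Fin 3) (Fin 2) ℝ) :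
    ∫⁻ ω, ENNReal.ofReal (eccentricity (c (perturbedProduct ε A (fun k => Ξ k ω) n) * M)) ∂μ
      ≤ 2 * ENNReal.ofReal (contractionRate N) ^ n := by
  have hN0 : 0 < N := by
    have : (0 : ℝ) < N := lt_of_lt_of_le (by positivity) hN
    exact_mod_cast this
  have mK : Measurable fun ω => c (perturbedProduct ε A (fun k => Ξ k ω) n) * M := by
    have := hc.continuous
    have h2 : Continuous fun Q : Matrix (Fin 3) (Fin 3) ℝ => c Q * M := by fun_prop
    exact h2.measurable.comp (measurable_perturbedProduct h ε A n)
  have hF := FrameFunction.iterated hc hA hε hε1 hN n frameFunction_discFrame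
  have hdouble := sq_lintegral_eccentricity_le (μ := μ) mK
  simp only [lintegral_frame_perturbedProduct h hc hc1 hA hε hε1 hN n frameFunction_discFrame M,
    ENNReal.ofReal_mul (zero_le_two (α := ℝ))] at hdouble
  rw [lintegral_const_mul' _ _ (by simp), ENNReal.ofReal_ofNat] at hdouble
  have hsq : (2 * ∫⁻ ω, ENNReal.ofReal
      (eccentricity (c (perturbedProduct ε A (fun k => Ξ k ω) n) * M)) ∂μ) ^ 2
      ≤ (2 * (2 * ENNReal.ofReal (contractionRate N) ^ n)) ^ 2 := by
    refine hdouble.trans (le_trans (mul_le_mul_right (hF.bound M) 4) (le_of_eq ?_))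
    rw [← contractionRate_sq hN0]; ring
  exact (ENNReal.mul_le_mul_iff_right (a := 2) (by norm_num) (by norm_num)).1
    ((ENNReal.pow_le_pow_left_iff two_ne_zero).1 hsq)

/-- The standard basis of the coordinate plane orthogonal to the `i`-th axis. -/
def coordinateFrame (i : Fin 3) : Matrix (Fin 3) (Fin 2) ℝ :=
  Matrix.of fun a b => if a = i.succAbove b then 1 else 0

lemma mul_coordinateFrame (Q : Matrix (Fin 3) (Fin 3) ℝ) (i a : Fin 3) (b : Fin 2) :
    (Q * coordinateFrame i) a b = Q a (i.succAbove b) := by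
  simp [Matrix.mul_apply, coordinateFrame]

lemma frobSq_cofactorMatrix (Q : Matrix (Fin 3) (Fin 3) ℝ) :
    frobSq (cofactorMatrix Q) = ∑ i, areaSq (Q * coordinateFrame i) := by
  simp only [areaSq_eq, mul_coordinateFrame, frobSq, cofactorMatrix, Matrix.adjugate_fin_three,
    Fin.sum_univ_three]
  simp [Fin.succAbove, Fin.lt_def]
  ring

lemma frobSq_mul_coordinateFrame_le (Q : Matrix (Fin 3) (Fin 3) ℝ) (i : Fin 3) :
    frobSq (Q * coordinateFrame i) ≤ frobSq Q := by
  simp only [frobSq, mul_coordinateFrame]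
  refine Finset.sum_le_sum fun a _ => ?_
  rw [Fin.sum_univ_succAbove (fun j => Q a j ^ 2) i]
  linarith [sq_nonneg (Q a i)]

lemma sqrt_frobSq_cofactorMatrix_div_le (Q : Matrix (Fin 3) (Fin 3) ℝ) :
    √(frobSq (cofactorMatrix Q)) / frobSq Q
      ≤ ∑ i, eccentricity (Q * coordinateFrame i) := by
  have h1 : √(frobSq (cofactorMatrix Q)) ≤ ∑ i, √(areaSq (Q * coordinateFrame i)) := by
    rw [frobSq_cofactorMatrix]
    refine Real.sqrt_le_iff.2 ⟨Finset.sum_nonneg fun _ _ => Real.sqrt_nonneg _, ?_⟩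
    have h := fun i => Real.sq_sqrt (areaSq_nonneg (Q * coordinateFrame i))
    calc ∑ i, areaSq (Q * coordinateFrame i) = ∑ i, √(areaSq (Q * coordinateFrame i)) ^ 2 := by
          simp only [h]
      _ ≤ _ := Finset.sum_sq_le_sq_sum_of_nonneg fun _ _ => Real.sqrt_nonneg _
  calc _ ≤ (∑ i, √(areaSq (Q * coordinateFrame i))) / frobSq Q := by
        gcongr; exact frobSq_nonneg _
    _ = ∑ i, √(areaSq (Q * coordinateFrame i)) / frobSq Q := by rw [Finset.sum_div]
    _ ≤ _ := by
        refine Finset.sum_le_sum fun i _ => ?_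
        rw [eccentricity]
        rcases (frobSq_nonneg (Q * coordinateFrame i)).eq_or_lt with h0 | h0
        · have := two_mul_sqrt_areaSq_le (Q * coordinateFrame i)
          have h3 : √(areaSq (Q * coordinateFrame i)) = 0 :=
            le_antisymm (by linarith) (Real.sqrt_nonneg _)
          simp [h3]
        · exact div_le_div_of_nonneg_left (Real.sqrt_nonneg _) h0 (frobSq_mul_coordinateFrame_le Q i)

/-- The expected ratio of the two largest singular values of `c P_n`, up to constants, decays
exponentially. The cofactor matrix collects the areas of the images of the coordinate planes. -/
lemma lintegral_sqrt_frobSq_div_le (h : IsUniformNoise μ Ξ) (hc : ShearsFrames c) (hc1 : c 1 = 1)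
    (hA : ∀ n i j, |A n i j| ≤ 1) (hε : 0 < ε) (hε1 : ε < 1) (hN : 9 / ε ≤ N) (n : ℕ) :
    ∫⁻ ω, ENNReal.ofReal (√(frobSq (cofactorMatrix (c (perturbedProduct ε A (fun k => Ξ k ω) n))))
        / frobSq (c (perturbedProduct ε A (fun k => Ξ k ω) n))) ∂μ
      ≤ 6 * ENNReal.ofReal (contractionRate N) ^ n := by
  have mP := measurable_perturbedProduct h ε A n
  have hm : ∀ i, Measurable fun ω => ENNReal.ofReal
      (eccentricity (c (perturbedProduct ε A (fun k => Ξ k ω) n) * coordinateFrame i)) := fun i => by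
    have h1 := hc.continuous
    have h2 : Continuous fun Q : Matrix (Fin 3) (Fin 3) ℝ => c Q * coordinateFrame i := by fun_prop
    exact ENNReal.measurable_ofReal.comp (measurable_eccentricity.comp (h2.measurable.comp mP))
  calc _ ≤ ∫⁻ ω, ∑ i, ENNReal.ofReal
          (eccentricity (c (perturbedProduct ε A (fun k => Ξ k ω) n) * coordinateFrame i)) ∂μ := by
        refine lintegral_mono fun ω => ?_
        rw [← ENNReal.ofReal_sum_of_nonneg fun i _ => eccentricity_nonneg _]
        exact ENNReal.ofReal_le_ofReal (sqrt_frobSq_cofactorMatrix_div_le _)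
    _ = ∑ i, ∫⁻ ω, ENNReal.ofReal
        (eccentricity (c (perturbedProduct ε A (fun k => Ξ k ω) n) * coordinateFrame i)) ∂μ :=
        lintegral_finsetSum _ fun i _ => hm i
    _ ≤ ∑ _i : Fin 3, 2 * ENNReal.ofReal (contractionRate N) ^ n :=
        Finset.sum_le_sum fun i _ => lintegral_eccentricity_le h hc hc1 hA hε hε1 hN n _
    _ = _ := by
        rw [Finset.sum_const, Finset.card_univ, Fintype.card_fin, nsmul_eq_mul, ← mul_assoc]
        norm_num

end

/-! ### Singular values and cofactor matrices -/

/-- The characteristic polynomial of the Gram matrix, by the Cauchy-Binet formula. -/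
lemma det_smul_one_sub_transpose_mul_self (M : Matrix (Fin 3) (Fin 3) ℝ) (x : ℝ) :
    (x • (1 : Matrix (Fin 3) (Fin 3) ℝ) - Mᵀ * M).det
      = x ^ 3 - frobSq M * x ^ 2 + frobSq (cofactorMatrix M) * x - M.det ^ 2 := by
  simp only [Matrix.det_fin_three, frobSq, cofactorMatrix, Matrix.adjugate_fin_three,
    Fin.sum_univ_three, Matrix.sub_apply, Matrix.smul_apply, Matrix.mul_apply, Matrix.transpose_apply]
  simp
  ring

lemma prod_sub_sq_singularValue (M : Matrix (Fin 3) (Fin 3) ℝ) (x : ℝ) :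
    (x • (1 : Matrix (Fin 3) (Fin 3) ℝ) - Mᵀ * M).det = (x - matrixSingularValue M 0 ^ 2)
      * (x - matrixSingularValue M 1 ^ 2) * (x - matrixSingularValue M 2 ^ 2) := by
  have hn : Module.finrank ℝ (EuclideanSpace ℝ (Fin 3)) = 3 := by simp
  set T := Matrix.toEuclideanLin M with hT
  have hsym := T.isSymmetric_adjoint_comp_self
  have h1 := hsym.charpoly_eq hn
  have h2 : LinearMap.adjoint T ∘ₗ T = Matrix.toEuclideanLin (Mᵀ * M) := by
    rw [hT, ← Matrix.toEuclideanLin_conjTranspose_eq_adjoint, Matrix.conjTranspose_eq_transpose_of_trivial]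
    ext x i
    simp [Matrix.toLpLin_apply]
  have h3 : (LinearMap.adjoint T ∘ₗ T).charpoly = (Mᵀ * M).charpoly := by
    rw [h2, show Matrix.toEuclideanLin (Mᵀ * M) = _ from
      congrArg (· (Mᵀ * M)) (Matrix.toLpLin_eq_toLin 2 2), Matrix.charpoly_toLin]
  rw [h3] at h1
  have h4 := congrArg (Polynomial.eval x) h1
  rw [Matrix.eval_charpoly, Polynomial.eval_prod] at h4
  simp only [Polynomial.eval_sub, Polynomial.eval_X, Polynomial.eval_C, Fin.prod_univ_three] at h4
  have hs : ∀ i : Fin 3, matrixSingularValue M i ^ 2 = hsym.eigenvalues hn i := fun i =>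
    T.sq_singularValues_fin hn i
  have e0 := hs 0
  have e1 := hs 1
  have e2 := hs 2
  simp only [Fin.val_zero, Fin.val_one, Fin.val_two] at e0 e1 e2
  rw [e0, e1, e2]
  rw [Matrix.scalar_apply, ← Matrix.smul_one_eq_diagonal] at h4
  exact h4

/-- The invariants `frobSq M`, `frobSq (cofactorMatrix M)` and `M.det ^ 2` are the elementary
symmetric functions of the squared singular values. -/
lemma symmetric_functions_singularValue (M : Matrix (Fin 3) (Fin 3) ℝ) :
    frobSq M = matrixSingularValue M 0 ^ 2 + matrixSingularValue M 1 ^ 2 + matrixSingularValue M 2 ^ 2 ∧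
    frobSq (cofactorMatrix M) = matrixSingularValue M 0 ^ 2 * matrixSingularValue M 1 ^ 2
      + matrixSingularValue M 0 ^ 2 * matrixSingularValue M 2 ^ 2
      + matrixSingularValue M 1 ^ 2 * matrixSingularValue M 2 ^ 2 ∧
    M.det ^ 2 = matrixSingularValue M 0 ^ 2 * matrixSingularValue M 1 ^ 2 * matrixSingularValue M 2 ^ 2 := by
  have h := fun x => (det_smul_one_sub_transpose_mul_self M x).symm.trans (prod_sub_sq_singularValue M x)
  have h0 := h 0
  have h1 := h 1
  have h2 := h (-1)
  refine ⟨?_, ?_, ?_⟩ <;> linarith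

lemma matrixSingularValue_antitone (M : Matrix (Fin 3) (Fin 3) ℝ) : Antitone (matrixSingularValue M) :=
  (Matrix.toEuclideanLin M).singularValues_antitone

lemma matrixSingularValue_nonneg (M : Matrix (Fin 3) (Fin 3) ℝ) (j : ℕ) : 0 ≤ matrixSingularValue M j :=
  (Matrix.toEuclideanLin M).singularValues_nonneg j

lemma cofactorMatrix_cofactorMatrix (M : Matrix (Fin 3) (Fin 3) ℝ) :
    cofactorMatrix (cofactorMatrix M) = M.det • M := by
  rw [cofactorMatrix, cofactorMatrix, Matrix.adjugate_transpose, Matrix.transpose_transpose,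
    Matrix.adjugate_adjugate _ (by simp)]
  simp

lemma frobSq_smul (a : ℝ) (M : Matrix (Fin 3) (Fin 3) ℝ) : frobSq (a • M) = a ^ 2 * frobSq M := by
  simp [frobSq, Finset.mul_sum, mul_pow]

/-- The action of a matrix on vectors for `j = 0` and, up to identifying planes with their normals, on
planes for `j = 1`. -/
noncomputable def exteriorAction (j : Fin 2) : Matrix (Fin 3) (Fin 3) ℝ → Matrix (Fin 3) (Fin 3) ℝ :=
  ![id, cofactorMatrix] j

/-- A rational expression in the entries which is comparable with the square of the ratio
`s₂ / s₁` of the two largest singular values of `M`. -/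
noncomputable def areaRatio (M : Matrix (Fin 3) (Fin 3) ℝ) : ℝ :=
  frobSq (cofactorMatrix M) / frobSq M ^ 2

/-- A rational expression in the entries which is comparable with the square of the ratio
`s_{j+2} / s_{j+1}` of consecutive singular values of `M`. -/
noncomputable def gapRatio (j : Fin 2) (M : Matrix (Fin 3) (Fin 3) ℝ) : ℝ :=
  areaRatio (exteriorAction j M)

lemma matrixSingularValue_pos {M : Matrix (Fin 3) (Fin 3) ℝ} (hM : M.det ≠ 0) :
    0 < matrixSingularValue M 2 := by
  refine lt_of_le_of_ne (matrixSingularValue_nonneg M 2) fun h => ?_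
  have h3 := (symmetric_functions_singularValue M).2.2
  rw [← h] at h3
  apply hM
  simpa using h3

lemma gapRatio_bounds {M : Matrix (Fin 3) (Fin 3) ℝ} (hM : M.det ≠ 0) (j : Fin 2) :
    0 < gapRatio j M ∧
    (matrixSingularValue M j / matrixSingularValue M (j + 1)) ^ 2 ≤ 9 * (gapRatio j M)⁻¹ ∧
    (gapRatio j M)⁻¹ ≤ 9 * (matrixSingularValue M j / matrixSingularValue M (j + 1)) ^ 2 := by
  obtain ⟨h1, h2, h3⟩ := symmetric_functions_singularValue M
  have h4 : frobSq (cofactorMatrix (cofactorMatrix M)) = M.det ^ 2 * frobSq M := by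
    rw [cofactorMatrix_cofactorMatrix, frobSq_smul]
  have p2 := matrixSingularValue_pos hM
  have p12 := matrixSingularValue_antitone M (show 1 ≤ 2 by norm_num)
  have p01 := matrixSingularValue_antitone M (show 0 ≤ 1 by norm_num)
  have q2 := pow_pos p2 2
  have q12 := pow_le_pow_left₀ p2.le p12 2
  have q01 := pow_le_pow_left₀ (p2.le.trans p12) p01 2
  have key : ∀ a b c : ℝ, 0 < c → c ≤ b → b ≤ a →
      (a / b ≤ 9 * ((a * b + a * c + b * c) / (a + b + c) ^ 2)⁻¹ ∧
        ((a * b + a * c + b * c) / (a + b + c) ^ 2)⁻¹ ≤ 9 * (a / b)) ∧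
      (b / c ≤ 9 * ((a * b * c * (a + b + c)) / (a * b + a * c + b * c) ^ 2)⁻¹ ∧
        ((a * b * c * (a + b + c)) / (a * b + a * c + b * c) ^ 2)⁻¹ ≤ 9 * (b / c)) := by
    intro a b c hc hcb hba
    have hb := hc.trans_le hcb
    have ha := hb.trans_le hba
    have hs : a * b + a * c + b * c ≤ 3 * (a * b) := by nlinarith
    have hs' : a * b ≤ a * b + a * c + b * c := by nlinarith [mul_pos ha hc, mul_pos hb hc]
    have ht : a + b + c ≤ 3 * a := by linarith
    have ht' : a ≤ a + b + c := by linarith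
    have hab := mul_pos ha hb
    have e2 : (a + b + c) ^ 2 ≤ (3 * a) ^ 2 := pow_le_pow_left₀ (by positivity) ht 2
    have e2' : a ^ 2 ≤ (a + b + c) ^ 2 := pow_le_pow_left₀ ha.le ht' 2
    have f2 : (a * b + a * c + b * c) ^ 2 ≤ (3 * (a * b)) ^ 2 := pow_le_pow_left₀ (by positivity) hs 2
    have f2' : (a * b) ^ 2 ≤ (a * b + a * c + b * c) ^ 2 := pow_le_pow_left₀ hab.le hs' 2
    simp only [inv_div]
    refine ⟨⟨?_, ?_⟩, ?_, ?_⟩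
    · rw [← mul_div_assoc, div_le_div_iff₀ hb (by positivity)]
      calc a * (a * b + a * c + b * c) ≤ a * (3 * (a * b)) := by gcongr
        _ ≤ 9 * a ^ 2 * b := by nlinarith [mul_pos ha hab]
        _ ≤ 9 * (a + b + c) ^ 2 * b := by gcongr
    · rw [← mul_div_assoc, div_le_div_iff₀ (by positivity) hb]
      calc (a + b + c) ^ 2 * b ≤ (3 * a) ^ 2 * b := by gcongr
        _ = 9 * a * (a * b) := by ring
        _ ≤ _ := by gcongr
    · rw [← mul_div_assoc, div_le_div_iff₀ hc (by positivity)]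
      calc b * (a * b * c * (a + b + c)) ≤ b * (a * b * c * (3 * a)) := by gcongr
        _ = 3 * (a * b) ^ 2 * c := by ring
        _ ≤ 9 * (a * b + a * c + b * c) ^ 2 * c := by gcongr; norm_num
    · rw [← mul_div_assoc, div_le_div_iff₀ (by positivity) hc]
      calc (a * b + a * c + b * c) ^ 2 * c ≤ (3 * (a * b)) ^ 2 * c := by gcongr
        _ = 9 * b * (a * b * c * a) := by ring
        _ ≤ _ := by gcongr
  obtain ⟨k1, k2⟩ := key _ _ _ q2 q12 q01
  have q1 := q2.trans_le q12
  have q0 := q1.trans_le q01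
  fin_cases j
  · simp only [gapRatio, areaRatio, exteriorAction, id, Fin.zero_eta, Matrix.cons_val_zero, h1, h2, div_pow, zero_add]
    exact ⟨by positivity, k1⟩
  · simp only [gapRatio, areaRatio, exteriorAction, Fin.mk_one, Matrix.cons_val_one, h1, h2, h3, h4, div_pow, Nat.reduceAdd,
      Matrix.cons_val_fin_one]
    exact ⟨by positivity, k2⟩

/-! ### A negative moment of the determinant -/

lemma lintegral_Icc_zero_one_rpow_ne_top :
    ∫⁻ y in Set.Icc (0 : ℝ) 1, ENNReal.ofReal |y| ^ (-(1 / 2) : ℝ) ≠ ∞ := by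
  have h : IntegrableOn (fun y : ℝ => y ^ (-(1 / 2) : ℝ)) (Set.Ioc 0 1) volume :=
    (intervalIntegrable_iff_integrableOn_Ioc_of_le zero_le_one).1
      (intervalIntegral.intervalIntegrable_rpow' (by norm_num))
  rw [← Measure.restrict_congr_set Ioc_ae_eq_Icc]
  have h2 : ∫⁻ y in Set.Ioc (0 : ℝ) 1, ENNReal.ofReal |y| ^ (-(1 / 2) : ℝ)
      = ∫⁻ y in Set.Ioc (0 : ℝ) 1, ENNReal.ofReal (y ^ (-(1 / 2) : ℝ)) := by
    refine setLIntegral_congr_fun measurableSet_Ioc fun y hy => ?_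
    rw [abs_of_pos hy.1, ENNReal.ofReal_rpow_of_pos hy.1]
  rw [h2]
  exact h.lintegral_lt_top.ne

/-- The mean of `|α x + β| ^ (-1/2)` over `[-1, 1]` is controlled by `|α| ^ (-1/2)` alone. For `α = 0` the
right-hand side is infinite. -/
lemma exists_lintegral_affine_rpow_le :
    ∃ K : ℝ≥0∞, K ≠ ∞ ∧ ∀ α β : ℝ, ∫⁻ x, ENNReal.ofReal |α * x + β| ^ (-(1 / 2) : ℝ) ∂uniformLaw
      ≤ K * ENNReal.ofReal |α| ^ (-(1 / 2) : ℝ) := by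
  set f : ℝ → ℝ≥0∞ := fun y => ENNReal.ofReal |y| ^ (-(1 / 2) : ℝ) with hf
  have mf : Measurable f := by fun_prop
  set K₁ := ∫⁻ y in Set.Icc (0 : ℝ) 1, f y with hK₁
  have hK₁' : K₁ ≠ ∞ := lintegral_Icc_zero_one_rpow_ne_top
  have hneg : ∫⁻ y in Set.Icc (-1 : ℝ) 0, f y = K₁ := by
    have h := (Measure.measurePreserving_neg (volume : Measure ℝ)).setLIntegral_comp_preimage
      (measurableSet_Icc (a := (0 : ℝ)) (b := 1)) mf
    rw [hK₁, ← h]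
    simp [hf]
  refine ⟨2 + 2 * K₁, by finiteness, fun α β => ?_⟩
  by_cases hα : α = 0
  · have : ENNReal.ofReal |α| ^ (-(1 / 2) : ℝ) = ∞ := by
      rw [hα, abs_zero, ENNReal.ofReal_zero, ENNReal.zero_rpow_of_neg (by norm_num)]
    rw [this, ENNReal.mul_top (by simp)]
    exact le_top
  set s := -β / α with hs
  have h1 : ∀ x, ENNReal.ofReal |α * x + β| ^ (-(1 / 2) : ℝ)
      = ENNReal.ofReal |α| ^ (-(1 / 2) : ℝ) * f (x - s) := by
    intro x
    have : α * x + β = α * (x - s) := by rw [hs]; field_simp; ring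
    rw [this, abs_mul, ENNReal.ofReal_mul (abs_nonneg _), hf,
      ENNReal.mul_rpow_of_ne_top (by simp) (by simp)]
  simp only [h1]
  rw [lintegral_const_mul (f := fun x => f (x - s)) _ (mf.comp (measurable_sub_const s)), mul_comm]
  gcongr
  -- away from the interval `[-1, 1]` the function `f` is at most `1`
  have h2 : ∀ y, f y ≤ 1 + ((Set.Icc (-1 : ℝ) 0).indicator f y + (Set.Icc (0 : ℝ) 1).indicator f y) := by
    intro y
    by_cases hy0 : y ∈ Set.Icc (-1 : ℝ) 0
    · rw [Set.indicator_of_mem hy0, add_comm 1, add_assoc]; exact le_self_add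
    by_cases hy1 : y ∈ Set.Icc (0 : ℝ) 1
    · rw [Set.indicator_of_mem hy1, ← add_assoc]; exact le_add_self
    · refine le_trans ?_ le_self_add
      have hy : 1 ≤ |y| := by
        by_contra hcon
        push Not at hcon
        rw [abs_lt] at hcon
        rcases le_total y 0 with h | h
        · exact hy0 ⟨hcon.1.le, h⟩
        · exact hy1 ⟨h, hcon.2.le⟩
      rw [hf]
      simp only
      rw [ENNReal.rpow_neg, ENNReal.inv_le_one]
      exact ENNReal.one_le_rpow (by rwa [ENNReal.one_le_ofReal]) (by norm_num)
  have h3 : ∫⁻ y, ((Set.Icc (-1 : ℝ) 0).indicator f y + (Set.Icc (0 : ℝ) 1).indicator f y) = 2 * K₁ := by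
    rw [lintegral_add_left (mf.indicator measurableSet_Icc), lintegral_indicator measurableSet_Icc,
      lintegral_indicator measurableSet_Icc, hneg, two_mul]
  calc ∫⁻ x, f (x - s) ∂uniformLaw
      ≤ ∫⁻ x, 1 + ((Set.Icc (-1 : ℝ) 0).indicator f (x - s)
          + (Set.Icc (0 : ℝ) 1).indicator f (x - s)) ∂uniformLaw := lintegral_mono fun x => h2 _
    _ = 1 + ∫⁻ x, ((Set.Icc (-1 : ℝ) 0).indicator f (x - s)
          + (Set.Icc (0 : ℝ) 1).indicator f (x - s)) ∂uniformLaw := by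
        rw [lintegral_add_left measurable_const]; simp
    _ ≤ 1 + 2 * K₁ := by
        gcongr
        rw [uniformLaw_eq, lintegral_smul_measure, smul_eq_mul]
        calc _ ≤ 1 * ∫⁻ x, ((Set.Icc (-1 : ℝ) 0).indicator f (x - s)
              + (Set.Icc (0 : ℝ) 1).indicator f (x - s)) := by
              gcongr
              · rw [ENNReal.inv_le_one]; norm_num
              · exact Measure.restrict_le_self
          _ = _ := by
              rw [one_mul, lintegral_sub_right_eq_self (fun y => (Set.Icc (-1 : ℝ) 0).indicator f y
                + (Set.Icc (0 : ℝ) 1).indicator f y) s, h3]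
    _ ≤ 2 + 2 * K₁ := by gcongr; norm_num

section

variable {Ω : Type*} [MeasurableSpace Ω] {μ : Measure Ω} [IsProbabilityMeasure μ]
  {Ξ : ℕ → Ω → Matrix (Fin 3) (Fin 3) ℝ}

/-- The matrix `X` with the entry at `(a, b)` replaced by zero. -/
def eraseEntry (a b : Fin 3) (X : Matrix (Fin 3) (Fin 3) ℝ) : Matrix (Fin 3) (Fin 3) ℝ :=
  Matrix.of fun i j => if i = a ∧ j = b then 0 else X i j

omit [IsProbabilityMeasure μ] in
lemma IsUniformNoise.indepFun_eraseEntry (h : IsUniformNoise μ Ξ) (n : ℕ) (a b : Fin 3) :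
    IndepFun (fun ω => Ξ n ω a b) (fun ω => eraseEntry a b (Ξ n ω)) μ := by
  classical
  set T : Finset (ℕ × Fin 3 × Fin 3) :=
    ((Finset.univ : Finset (Fin 3 × Fin 3)).erase (a, b)).image fun q => (n, q) with hT
  have hind := h.independent_entries.indepFun_finset {(n, a, b)} T (by simp [hT])
    fun p => h.measurable_entry p.1 p.2.1 p.2.2
  set φ : (T → ℝ) → Matrix (Fin 3) (Fin 3) ℝ := fun y => Matrix.of fun i j =>
    if hij : (n, i, j) ∈ T then y ⟨_, hij⟩ else 0 with hφ
  have mφ : Measurable φ := by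
    refine measurable_pi_lambda _ fun i => measurable_pi_lambda _ fun j => ?_
    simp only [hφ, Matrix.of_apply]
    split_ifs with hij
    · exact measurable_pi_apply _
    · exact measurable_const
  have h2 := hind.comp (measurable_pi_apply (⟨(n, a, b), by simp⟩ : ({(n, a, b)} : Finset _))) mφ
  refine (congrArg (IndepFun _ · μ) (funext fun ω => ?_)).mpr h2
  ext i j
  simp only [eraseEntry, Function.comp_apply, hφ, Matrix.of_apply]
  by_cases hij : i = a ∧ j = b
  · rw [if_pos hij, dif_neg (by simp [hT, hij])]
  · rw [if_neg hij, dif_pos (by simp only [hT, Finset.mem_image]; exact ⟨(i, j), by simpa using hij, rfl⟩)]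

/-- Integrating out the entry at `(a, b)`, which is independent of the other entries. -/
lemma lintegral_affine_entry_le {K : ℝ≥0∞}
    (hK : ∀ α β : ℝ, ∫⁻ x, ENNReal.ofReal |α * x + β| ^ (-(1 / 2) : ℝ) ∂uniformLaw
      ≤ K * ENNReal.ofReal |α| ^ (-(1 / 2) : ℝ))
    (h : IsUniformNoise μ Ξ) (n : ℕ) (a b : Fin 3) {α β : Matrix (Fin 3) (Fin 3) ℝ → ℝ}
    (hα : Continuous α) (hβ : Continuous β) :
    ∫⁻ ω, ENNReal.ofReal |α (eraseEntry a b (Ξ n ω)) * Ξ n ω a b + β (eraseEntry a b (Ξ n ω))|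
        ^ (-(1 / 2) : ℝ) ∂μ
      ≤ K * ∫⁻ ω, ENNReal.ofReal |α (eraseEntry a b (Ξ n ω))| ^ (-(1 / 2) : ℝ) ∂μ := by
  have mV : Measurable fun ω => eraseEntry a b (Ξ n ω) := by
    refine measurable_pi_lambda _ fun i => measurable_pi_lambda _ fun j => ?_
    simp only [eraseEntry, Matrix.of_apply]
    split_ifs
    · exact measurable_const
    · exact h.measurable_entry n i j
  have mU := h.measurable_entry n a b
  have hprod := (h.indepFun_eraseEntry n a b).symm.map_prod_eq_prod_map_map mV.aemeasurable mU.aemeasurable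
  have hu : μ.map (fun ω => Ξ n ω a b) = uniformLaw := h.uniform_entry n a b
  rw [hu] at hprod
  set G : Matrix (Fin 3) (Fin 3) ℝ × ℝ → ℝ≥0∞ := fun p =>
    ENNReal.ofReal |α p.1 * p.2 + β p.1| ^ (-(1 / 2) : ℝ) with hG
  have hc : Continuous fun p : Matrix (Fin 3) (Fin 3) ℝ × ℝ => α p.1 * p.2 + β p.1 := by fun_prop
  have mG : Measurable G := (ENNReal.measurable_ofReal.comp hc.abs.measurable).pow_const _
  have mR : Measurable fun v : Matrix (Fin 3) (Fin 3) ℝ => ENNReal.ofReal |α v| ^ (-(1 / 2) : ℝ) :=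
    (ENNReal.measurable_ofReal.comp (continuous_abs.comp hα).measurable).pow_const _
  change ∫⁻ ω, G (eraseEntry a b (Ξ n ω), Ξ n ω a b) ∂μ ≤ _
  calc ∫⁻ ω, G (eraseEntry a b (Ξ n ω), Ξ n ω a b) ∂μ
      = ∫⁻ v, ∫⁻ x, G (v, x) ∂uniformLaw ∂(μ.map fun ω => eraseEntry a b (Ξ n ω)) := by
        rw [← lintegral_map mG (mV.prodMk mU), hprod, lintegral_prod _ mG.aemeasurable]
    _ ≤ ∫⁻ v, K * ENNReal.ofReal |α v| ^ (-(1 / 2) : ℝ) ∂(μ.map fun ω => eraseEntry a b (Ξ n ω)) :=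
        lintegral_mono fun v => hK (α v) (β v)
    _ = _ := by
        rw [lintegral_const_mul _ mR]
        exact congrArg (K * ·) (lintegral_map mR mV)

/-- A negative moment of the determinant of `A + ε X` is bounded uniformly in `A`. The determinant is
affine in each entry, so the diagonal entries are integrated out one after the other, each time
replacing a minor by a smaller one. -/
lemma exists_lintegral_det_rpow_le :
    ∃ K : ℝ≥0∞, K ≠ ∞ ∧ ∀ {Ω : Type*} [MeasurableSpace Ω] {μ : Measure Ω} [IsProbabilityMeasure μ]
      {Ξ : ℕ → Ω → Matrix (Fin 3) (Fin 3) ℝ}, IsUniformNoise μ Ξ →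
      ∀ (A : Matrix (Fin 3) (Fin 3) ℝ) (ε : ℝ) (n : ℕ),
      ∫⁻ ω, ENNReal.ofReal |(A + ε • Ξ n ω).det| ^ (-(1 / 2) : ℝ) ∂μ
        ≤ K * ENNReal.ofReal |ε ^ 3| ^ (-(1 / 2) : ℝ) := by
  obtain ⟨K, hKtop, hK⟩ := exists_lintegral_affine_rpow_le
  refine ⟨K * (K * K), by finiteness, fun {Ω} _ {μ} _ {Ξ} h A ε n => ?_⟩
  have step1 := lintegral_affine_entry_le hK h n 0 0
    (α := fun V => ε * ((A 1 1 + ε * V 1 1) * (A 2 2 + ε * V 2 2)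
      - (A 1 2 + ε * V 1 2) * (A 2 1 + ε * V 2 1)))
    (β := fun V => (A + ε • V).det) (by fun_prop) (by fun_prop)
  have step2 := lintegral_affine_entry_le hK h n 1 1
    (α := fun V => ε ^ 2 * (A 2 2 + ε * V 2 2))
    (β := fun V => ε * (A 1 1 * (A 2 2 + ε * V 2 2) - (A 1 2 + ε * V 1 2) * (A 2 1 + ε * V 2 1)))
    (by fun_prop) (by fun_prop)
  have step3 := lintegral_affine_entry_le hK h n 2 2
    (α := fun _ => ε ^ 3) (β := fun _ => ε ^ 2 * A 2 2) (by fun_prop) (by fun_prop)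
  rw [lintegral_const, measure_univ, mul_one] at step3
  have e1 : ∀ X : Matrix (Fin 3) (Fin 3) ℝ, (A + ε • X).det = ε * ((A 1 1 + ε * eraseEntry 0 0 X 1 1)
      * (A 2 2 + ε * eraseEntry 0 0 X 2 2) - (A 1 2 + ε * eraseEntry 0 0 X 1 2)
      * (A 2 1 + ε * eraseEntry 0 0 X 2 1)) * X 0 0 + (A + ε • eraseEntry 0 0 X).det := by
    intro X
    simp [Matrix.det_fin_three, eraseEntry]
    ring
  have e2 : ∀ X : Matrix (Fin 3) (Fin 3) ℝ, ε * ((A 1 1 + ε * eraseEntry 0 0 X 1 1)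
      * (A 2 2 + ε * eraseEntry 0 0 X 2 2) - (A 1 2 + ε * eraseEntry 0 0 X 1 2)
      * (A 2 1 + ε * eraseEntry 0 0 X 2 1))
      = ε ^ 2 * (A 2 2 + ε * eraseEntry 1 1 X 2 2) * X 1 1 + ε * (A 1 1 * (A 2 2 + ε * eraseEntry 1 1 X 2 2)
        - (A 1 2 + ε * eraseEntry 1 1 X 1 2) * (A 2 1 + ε * eraseEntry 1 1 X 2 1)) := by
    intro X
    simp [eraseEntry]
    ring
  have e3 : ∀ X : Matrix (Fin 3) (Fin 3) ℝ, ε ^ 2 * (A 2 2 + ε * eraseEntry 1 1 X 2 2)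
      = ε ^ 3 * X 2 2 + ε ^ 2 * A 2 2 := by
    intro X
    simp [eraseEntry]
    ring
  simp only [← e1] at step1
  simp only [← e2] at step2
  simp only [← e3] at step3
  calc _ ≤ _ := step1
    _ ≤ K * (K * (K * ENNReal.ofReal |ε ^ 3| ^ (-(1 / 2) : ℝ))) := by
        gcongr
        refine step2.trans ?_
        gcongr
    _ = _ := by ring

end

/-! ### Deterministic estimates for products -/

lemma shearsFrames_exteriorAction (j : Fin 2) : ShearsFrames (exteriorAction j) := by
  fin_cases j
  · exact shearsFrames_id
  · exact shearsFrames_cofactorMatrix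

lemma exteriorAction_one (j : Fin 2) : exteriorAction j 1 = 1 := by
  fin_cases j <;> simp [exteriorAction, cofactorMatrix]

lemma det_exteriorAction_ne_zero {M : Matrix (Fin 3) (Fin 3) ℝ} (hM : M.det ≠ 0) (j : Fin 2) :
    (exteriorAction j M).det ≠ 0 := by
  fin_cases j
  · exact hM
  · simpa [exteriorAction, cofactorMatrix, Matrix.det_adjugate] using hM

lemma frobSq_mul_le (M R : Matrix (Fin 3) (Fin 3) ℝ) : frobSq (M * R) ≤ frobSq M * frobSq R := by
  have h : ∀ i j, (M * R) i j ^ 2 ≤ (∑ k, M i k ^ 2) * ∑ k, R k j ^ 2 := fun i j => by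
    rw [Matrix.mul_apply]
    exact Finset.sum_mul_sq_le_sq_mul_sq _ _ _
  calc frobSq (M * R) ≤ ∑ i, ∑ j, (∑ k, M i k ^ 2) * ∑ k, R k j ^ 2 :=
        Finset.sum_le_sum fun i _ => Finset.sum_le_sum fun j _ => h i j
    _ = (∑ i, ∑ k, M i k ^ 2) * ∑ j, ∑ k, R k j ^ 2 := by
        rw [Finset.sum_mul_sum]
    _ = _ := by rw [frobSq, frobSq, Finset.sum_comm (f := fun j k => R k j ^ 2)]

lemma frobSq_pos {M : Matrix (Fin 3) (Fin 3) ℝ} (hM : M.det ≠ 0) : 0 < frobSq M := by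
  rw [(symmetric_functions_singularValue M).1]
  have := matrixSingularValue_pos hM
  positivity

lemma frobSq_cofactorMatrix_le (M : Matrix (Fin 3) (Fin 3) ℝ) :
    frobSq (cofactorMatrix M) ≤ frobSq M ^ 2 := by
  obtain ⟨h1, h2, -⟩ := symmetric_functions_singularValue M
  rw [h1, h2]
  have h : ∀ x y z : ℝ, 0 ≤ x → 0 ≤ y → 0 ≤ z → x * y + x * z + y * z ≤ (x + y + z) ^ 2 := by
    intro x y z hx hy hz
    nlinarith [mul_nonneg hx hy, mul_nonneg hx hz, mul_nonneg hy hz]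
  exact h _ _ _ (sq_nonneg _) (sq_nonneg _) (sq_nonneg _)

/-- The gap is at most polynomial in the size and the inverse determinant of the matrix. -/
lemma gapRatio_inv_le {M : Matrix (Fin 3) (Fin 3) ℝ} (hM : M.det ≠ 0) (j : Fin 2) :
    (gapRatio j M)⁻¹ ≤ frobSq M ^ 3 / M.det ^ 2 := by
  have hf := frobSq_pos hM
  have hg : 0 < frobSq (cofactorMatrix M) := frobSq_pos (det_exteriorAction_ne_zero hM 1)
  have h1 := frobSq_cofactorMatrix_le M
  have h2 := frobSq_cofactorMatrix_le (cofactorMatrix M)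
  have hd : 0 < M.det ^ 2 := by positivity
  rw [cofactorMatrix_cofactorMatrix, frobSq_smul] at h2
  fin_cases j
  · simp only [gapRatio, areaRatio, exteriorAction, id, Fin.zero_eta, Matrix.cons_val_zero, inv_div]
    rw [div_le_div_iff₀ hg hd]
    have h3 : M.det ^ 2 * frobSq M ≤ frobSq (cofactorMatrix M) * frobSq M ^ 2 := by
      refine h2.trans ?_
      rw [sq]
      gcongr
    calc frobSq M ^ 2 * M.det ^ 2 = frobSq M * (M.det ^ 2 * frobSq M) := by ring
      _ ≤ frobSq M * (frobSq (cofactorMatrix M) * frobSq M ^ 2) := by gcongr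
      _ = _ := by ring
  · simp only [gapRatio, areaRatio, exteriorAction, Fin.mk_one, Matrix.cons_val_one,
      Matrix.cons_val_fin_one, inv_div, cofactorMatrix_cofactorMatrix, frobSq_smul]
    rw [div_le_div_iff₀ (by positivity) hd]
    calc frobSq (cofactorMatrix M) ^ 2 * M.det ^ 2 ≤ (frobSq M ^ 2) ^ 2 * M.det ^ 2 := by gcongr
      _ = _ := by ring

/-- The logarithm of the ratio of two consecutive singular values equals `-(1/2) log (gapRatio j M)` up to a
bounded error. -/
lemma abs_log_ratio_add_log_gapRatio_le {M : Matrix (Fin 3) (Fin 3) ℝ} (hM : M.det ≠ 0) (j : Fin 2) :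
    |Real.log (matrixSingularValue M j / matrixSingularValue M (j + 1))
      - -(1 / 2) * Real.log (gapRatio j M)| ≤ Real.log 9 := by
  obtain ⟨h0, h1, h2⟩ := gapRatio_bounds hM j
  set r := matrixSingularValue M j / matrixSingularValue M (j + 1)
  have hr : r ≠ 0 := by
    intro h
    rw [h] at h2
    have := inv_pos.2 h0
    simp at h2
    linarith
  have hr2 : 0 < r ^ 2 := by positivity
  have k1 := Real.log_le_log hr2 h1
  have k2 := Real.log_le_log (inv_pos.2 h0) h2
  rw [Real.log_mul (by norm_num) (inv_pos.2 h0).ne', Real.log_inv, Real.log_pow] at k1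
  rw [Real.log_mul (by norm_num) hr2.ne', Real.log_inv, Real.log_pow] at k2
  have h9 : 0 ≤ Real.log 9 := Real.log_nonneg (by norm_num)
  push_cast at k1 k2
  rw [abs_le]
  constructor <;> linarith

lemma det_perturbedProduct (ε : ℝ) (A X : ℕ → Matrix (Fin 3) (Fin 3) ℝ) (n : ℕ) :
    (perturbedProduct ε A X n).det = ∏ k ∈ Finset.range n, (A k + ε • X k).det := by
  induction n with
  | zero => simp [perturbedProduct]
  | succ n ih => rw [perturbedProduct, Matrix.det_mul, ih, Finset.prod_range_succ, mul_comm]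

lemma det_perturbedProduct_ne_zero {ε : ℝ} {A X : ℕ → Matrix (Fin 3) (Fin 3) ℝ}
    (h : ∀ k, (A k + ε • X k).det ≠ 0) (n : ℕ) : (perturbedProduct ε A X n).det ≠ 0 := by
  rw [det_perturbedProduct]
  exact Finset.prod_ne_zero_iff.2 fun k _ => h k

lemma perturbedProduct_add (ε : ℝ) (A X : ℕ → Matrix (Fin 3) (Fin 3) ℝ) (m n : ℕ) :
    perturbedProduct ε A X (n + m)
      = perturbedProduct ε (fun k => A (k + m)) (fun k => X (k + m)) n * perturbedProduct ε A X m := by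
  induction n with
  | zero => simp [perturbedProduct]
  | succ n ih => rw [Nat.add_right_comm, perturbedProduct, ih, perturbedProduct, Matrix.mul_assoc]

lemma frobSq_perturbedProduct_le {ε : ℝ} {A X : ℕ → Matrix (Fin 3) (Fin 3) ℝ}
    (hA : ∀ n i j, |A n i j| ≤ 1) (hε : 0 < ε) (hε1 : ε < 1) (hX : ∀ n i j, |X n i j| ≤ 1) (n : ℕ) :
    frobSq (perturbedProduct ε A X n) ≤ 3 * 36 ^ n := by
  induction n with
  | zero => simp [perturbedProduct, frobSq, Matrix.one_apply]
  | succ n ih =>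
    have h : frobSq (A n + ε • X n) ≤ 36 := by
      have : ∀ i j, (A n + ε • X n) i j ^ 2 ≤ 4 := by
        intro i j
        have h1 := abs_le.1 (hA n i j)
        have h2 : |ε * X n i j| ≤ 1 := by
          rw [abs_mul, abs_of_pos hε]
          nlinarith [hX n i j, abs_nonneg (X n i j)]
        have h3 := abs_le.1 h2
        simp only [Matrix.add_apply, Matrix.smul_apply, smul_eq_mul]
        nlinarith
      calc frobSq (A n + ε • X n) ≤ ∑ _i : Fin 3, ∑ _j : Fin 3, (4 : ℝ) :=
            Finset.sum_le_sum fun i _ => Finset.sum_le_sum fun j _ => this i j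
        _ = 36 := by norm_num
    calc frobSq (perturbedProduct ε A X (n + 1))
        ≤ frobSq (A n + ε • X n) * frobSq (perturbedProduct ε A X n) := frobSq_mul_le _ _
      _ ≤ 36 * (3 * 36 ^ n) := by gcongr; exact frobSq_nonneg _
      _ = _ := by ring

lemma neg_log_le_two_mul_rpow {d : ℝ} (hd : 0 < d) : -Real.log d ≤ 2 * d ^ (-(1 / 2) : ℝ) := by
  have h := Real.log_le_sub_one_of_pos (Real.rpow_pos_of_pos hd (-(1 / 2)))
  rw [Real.log_rpow hd] at h
  linarith

/-- The growth rate of the gap, computed from `gapRatio` instead of the singular values. -/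
noncomputable def gapRate (j : Fin 2) (P : ℕ → Matrix (Fin 3) (Fin 3) ℝ) : EReal :=
  liminf (fun n : ℕ => (((1 / (n : ℝ)) * (-(1 / 2) * Real.log (gapRatio j (P n))) : ℝ) : EReal)) atTop

/-- Sequences of reals with difference tending to zero have the same lower limit in `EReal`. -/
lemma liminf_coe_eq_of_tendsto_sub {u v : ℕ → ℝ} (h : Tendsto (fun n => u n - v n) atTop (𝓝 0)) :
    liminf (fun n => (u n : EReal)) atTop = liminf (fun n => (v n : EReal)) atTop := by
  have key : ∀ {u v : ℕ → ℝ}, Tendsto (fun n => u n - v n) atTop (𝓝 0) →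
      liminf (fun n => (v n : EReal)) atTop ≤ liminf (fun n => (u n : EReal)) atTop := by
    intro u v h
    have h0 : liminf (fun n => ((u n - v n : ℝ) : EReal)) atTop = 0 := by
      have := (EReal.tendsto_coe.2 h).liminf_eq
      simpa using this
    have h1 := EReal.le_liminf_add (f := atTop) (u := fun n => (v n : EReal))
      (v := fun n => ((u n - v n : ℝ) : EReal))
    rw [h0, add_zero] at h1
    refine h1.trans (le_of_eq (liminf_congr (Eventually.of_forall fun n => ?_)))
    simp only [Pi.add_apply]
    rw [← EReal.coe_add, add_sub_cancel]
  refine le_antisymm (key ?_) (key h)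
  have := h.neg
  simpa using this

lemma tendsto_of_abs_le_div {w : ℕ → ℝ} {C : ℝ} (h : ∀ n, |w n| ≤ C / n) : Tendsto w atTop (𝓝 0) :=
  squeeze_zero_norm (fun n => by simpa using h n) (tendsto_const_div_atTop_nhds_zero_nat C)

lemma gapGrowthRate_eq_gapRate {P : ℕ → Matrix (Fin 3) (Fin 3) ℝ} (hP : ∀ n, (P n).det ≠ 0) (j : Fin 2) :
    gapGrowthRate P j = gapRate j P := by
  refine liminf_coe_eq_of_tendsto_sub (tendsto_of_abs_le_div (C := Real.log 9) fun n => ?_)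
  rw [← mul_sub, abs_mul, abs_of_nonneg (by positivity), one_div, inv_mul_eq_div]
  gcongr
  exact abs_log_ratio_add_log_gapRatio_le (hP n) j

lemma areaRatio_pos {M : Matrix (Fin 3) (Fin 3) ℝ} (hM : M.det ≠ 0) : 0 < areaRatio M :=
  (gapRatio_bounds hM 0).1

lemma areaRatio_mul_le {M R : Matrix (Fin 3) (Fin 3) ℝ} (hM : M.det ≠ 0) (hR : R.det ≠ 0) :
    areaRatio (M * R) ≤ areaRatio M * (frobSq (cofactorMatrix R) * frobSq R⁻¹ ^ 2) := by
  have hMR : (M * R).det ≠ 0 := by rw [Matrix.det_mul]; exact mul_ne_zero hM hR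
  have f1 := frobSq_pos hM
  have f2 := frobSq_pos hMR
  have hM' : frobSq M ≤ frobSq (M * R) * frobSq R⁻¹ := by
    have := frobSq_mul_le (M * R) R⁻¹
    rwa [Matrix.mul_nonsing_inv_cancel_right _ _ (isUnit_iff_ne_zero.2 hR)] at this
  rw [areaRatio, areaRatio, div_mul_eq_mul_div, div_le_div_iff₀ (by positivity) (by positivity),
    cofactorMatrix_mul]
  calc frobSq (cofactorMatrix M * cofactorMatrix R) * frobSq M ^ 2
      ≤ (frobSq (cofactorMatrix M) * frobSq (cofactorMatrix R)) * (frobSq (M * R) * frobSq R⁻¹) ^ 2 := by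
        gcongr
        · exact mul_nonneg (frobSq_nonneg _) (frobSq_nonneg _)
        · exact frobSq_mul_le _ _
    _ = _ := by ring

/-- Multiplying by a fixed matrix on the right changes `areaRatio` by a bounded factor. -/
lemma exists_abs_log_areaRatio_mul_sub_le {R : Matrix (Fin 3) (Fin 3) ℝ} (hR : R.det ≠ 0) :
    ∃ C : ℝ, ∀ M : Matrix (Fin 3) (Fin 3) ℝ, M.det ≠ 0 →
      |Real.log (areaRatio (M * R)) - Real.log (areaRatio M)| ≤ C := by
  have hR' : (R⁻¹).det ≠ 0 := by
    rw [Matrix.det_nonsing_inv, Ring.inverse_eq_inv']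
    exact inv_ne_zero hR
  have hp : ∀ {R : Matrix (Fin 3) (Fin 3) ℝ}, R.det ≠ 0 → (R⁻¹).det ≠ 0 →
      0 < frobSq (cofactorMatrix R) * frobSq R⁻¹ ^ 2 := fun h h' =>
    mul_pos (frobSq_pos (det_exteriorAction_ne_zero h 1)) (pow_pos (frobSq_pos h') 2)
  set K₁ := frobSq (cofactorMatrix R) * frobSq R⁻¹ ^ 2 with hK₁
  set K₂ := frobSq (cofactorMatrix R⁻¹) * frobSq R⁻¹⁻¹ ^ 2 with hK₂
  have p₁ : 0 < K₁ := hp hR hR'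
  have p₂ : 0 < K₂ := hp hR' (by rwa [Matrix.nonsing_inv_nonsing_inv _ (isUnit_iff_ne_zero.2 hR)])
  refine ⟨|Real.log K₁| + |Real.log K₂|, fun M hM => ?_⟩
  have hMR : (M * R).det ≠ 0 := by rw [Matrix.det_mul]; exact mul_ne_zero hM hR
  have h1 := areaRatio_mul_le hM hR
  have h2 := areaRatio_mul_le hMR hR'
  rw [Matrix.mul_nonsing_inv_cancel_right _ _ (isUnit_iff_ne_zero.2 hR)] at h2
  have k1 := Real.log_le_log (areaRatio_pos hMR) h1
  have k2 := Real.log_le_log (areaRatio_pos hM) h2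
  rw [Real.log_mul (areaRatio_pos hM).ne' p₁.ne'] at k1
  rw [Real.log_mul (areaRatio_pos hMR).ne' p₂.ne'] at k2
  have a1 := le_abs_self (Real.log K₁)
  have a2 := le_abs_self (Real.log K₂)
  have b1 := abs_nonneg (Real.log K₁)
  have b2 := abs_nonneg (Real.log K₂)
  rw [abs_le]
  constructor <;> linarith

/-! ### Almost sure bounds for the growth rate -/

section

variable {Ω : Type*} [MeasurableSpace Ω] {μ : Measure Ω} [IsProbabilityMeasure μ]
  {Ξ : ℕ → Ω → Matrix (Fin 3) (Fin 3) ℝ} {A : ℕ → Matrix (Fin 3) (Fin 3) ℝ} {ε : ℝ}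

omit [IsProbabilityMeasure μ] in
lemma IsUniformNoise.measurable_det_rpow (h : IsUniformNoise μ Ξ) (A : ℕ → Matrix (Fin 3) (Fin 3) ℝ)
    (ε : ℝ) (n : ℕ) :
    Measurable fun ω => ENNReal.ofReal |(A n + ε • Ξ n ω).det| ^ (-(1 / 2) : ℝ) := by
  have hc : Continuous fun X : Matrix (Fin 3) (Fin 3) ℝ => |(A n + ε • X).det| := by fun_prop
  exact (ENNReal.measurable_ofReal.comp (hc.measurable.comp (h.measurable n))).pow_const _

/-- The factors are almost surely invertible, since `|det|^(-1/2)` is integrable and takes the value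
`∞` at singular matrices. -/
lemma IsUniformNoise.ae_det_ne_zero (h : IsUniformNoise μ Ξ) (A : ℕ → Matrix (Fin 3) (Fin 3) ℝ)
    (hε : 0 < ε) : ∀ᵐ ω ∂μ, ∀ n, (A n + ε • Ξ n ω).det ≠ 0 := by
  obtain ⟨K, hK, hK'⟩ := exists_lintegral_det_rpow_le
  rw [ae_all_iff]
  intro n
  have hfin : ∫⁻ ω, ENNReal.ofReal |(A n + ε • Ξ n ω).det| ^ (-(1 / 2) : ℝ) ∂μ ≠ ∞ := by
    refine ne_top_of_le_ne_top (ENNReal.mul_ne_top hK ?_) (hK' h (A n) ε n)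
    exact ENNReal.rpow_ne_top_of_ne_zero (by simpa using hε.ne') ENNReal.ofReal_ne_top
  filter_upwards [ae_lt_top (h.measurable_det_rpow A ε n) hfin] with ω hω hdet
  rw [hdet, abs_zero, ENNReal.ofReal_zero, ENNReal.zero_rpow_of_neg (by norm_num)] at hω
  exact lt_irrefl _ hω

omit [IsProbabilityMeasure μ] in
lemma IsUniformNoise.ae_abs_le_one (h : IsUniformNoise μ Ξ) :
    ∀ᵐ ω ∂μ, ∀ n a b, |Ξ n ω a b| ≤ 1 := by
  simp only [ae_all_iff]
  intro n a b
  have h1 : ∀ᵐ x ∂(μ.map fun ω => Ξ n ω a b), |x| ≤ 1 := by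
    rw [h.uniform_entry n a b]
    filter_upwards [ae_cond_mem measurableSet_Icc] with x hx using abs_le.2 hx
  exact ae_of_ae_map (h.measurable_entry n a b).aemeasurable h1

/-- The growth rate is almost surely not `+∞`: by Fatou's lemma, the averages of the integrable variables
`|det (A k + ε Ξ k)| ^ (-1/2)` have almost surely a finite lower limit, and they control the growth of the
gap. -/
lemma IsUniformNoise.ae_gapRate_lt_top (h : IsUniformNoise μ Ξ) (hA : ∀ n i j, |A n i j| ≤ 1)
    (hε : 0 < ε) (hε1 : ε < 1) (j : Fin 2) :
    ∀ᵐ ω ∂μ, gapRate j (perturbedProduct ε A (fun k => Ξ k ω)) < ⊤ := by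
  obtain ⟨K, hK, hK'⟩ := exists_lintegral_det_rpow_le
  set D : ℕ → Ω → ℝ≥0∞ := fun k ω => ENNReal.ofReal |(A k + ε • Ξ k ω).det| ^ (-(1 / 2) : ℝ) with hD
  set S : ℕ → Ω → ℝ≥0∞ := fun n ω => (n : ℝ≥0∞)⁻¹ * ∑ k ∈ Finset.range n, D k ω with hS
  have mD : ∀ k, Measurable (D k) := h.measurable_det_rpow A ε
  have mS : ∀ n, Measurable (S n) := fun n =>
    (Finset.measurable_sum _ fun k _ => mD k).const_mul _
  set K₂ := K * ENNReal.ofReal |ε ^ 3| ^ (-(1 / 2) : ℝ) with hK₂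
  have hK₂top : K₂ ≠ ∞ := ENNReal.mul_ne_top hK
    (ENNReal.rpow_ne_top_of_ne_zero (by simpa using hε.ne') ENNReal.ofReal_ne_top)
  have hint : ∀ n, ∫⁻ ω, S n ω ∂μ ≤ K₂ := by
    intro n
    rw [lintegral_const_mul _ (Finset.measurable_sum _ fun k _ => mD k),
      lintegral_finsetSum _ fun k _ => mD k]
    calc (n : ℝ≥0∞)⁻¹ * ∑ k ∈ Finset.range n, ∫⁻ ω, D k ω ∂μ
        ≤ (n : ℝ≥0∞)⁻¹ * ∑ k ∈ Finset.range n, K₂ := by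
          gcongr with k
          exact hK' h (A k) ε k
      _ = ((n : ℝ≥0∞)⁻¹ * n) * K₂ := by simp [mul_assoc]
      _ ≤ 1 * K₂ := by gcongr; exact ENNReal.inv_mul_le_one _
      _ = K₂ := one_mul _
  have hfatou : ∫⁻ ω, liminf (fun n => S n ω) atTop ∂μ ≠ ∞ := by
    refine ne_top_of_le_ne_top hK₂top ((lintegral_liminf_le mS).trans ?_)
    exact liminf_le_of_frequently_le' (Frequently.of_forall hint)
  filter_upwards [ae_lt_top (Measurable.liminf mS) hfatou, h.ae_det_ne_zero A hε, h.ae_abs_le_one]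
    with ω hω hdet hX
  obtain ⟨R, hR, hR'⟩ := ENNReal.lt_iff_exists_nnreal_btwn.1 hω
  have hfreq := (frequently_lt_of_liminf_lt (by isBoundedDefault) hR).and_eventually (eventually_gt_atTop 0)
  set P := perturbedProduct ε A (fun k => Ξ k ω) with hP
  have hle : gapRate j P ≤ ((3 / 2 * (Real.log 3 + Real.log 36) + 2 * R : ℝ) : EReal) := by
    refine liminf_le_of_frequently_le' (hfreq.mono ?_)
    rintro n ⟨hn, hn0⟩
    rw [EReal.coe_le_coe_iff]
    have hn1 : (1 : ℝ) ≤ n := by exact_mod_cast hn0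
    have hPn : (P n).det ≠ 0 := det_perturbedProduct_ne_zero hdet n
    have hg := (gapRatio_bounds hPn j).1
    have h1 := Real.log_le_log (inv_pos.2 hg) (gapRatio_inv_le hPn j)
    have hf := frobSq_pos hPn
    rw [Real.log_inv, Real.log_div (by positivity) (by positivity), Real.log_pow, Real.log_pow,
      hP, det_perturbedProduct, Real.log_prod fun k _ => hdet k, ← hP] at h1
    have h2 := Real.log_le_log hf (frobSq_perturbedProduct_le hA hε hε1 hX n)
    rw [Real.log_mul (by norm_num) (by positivity), Real.log_pow] at h2
    have h3 : ∀ k, -Real.log (A k + ε • Ξ k ω).det ≤ 2 * (D k ω).toReal := by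
      intro k
      have := neg_log_le_two_mul_rpow (abs_pos.2 (hdet k))
      rwa [Real.log_abs, ← ENNReal.toReal_ofReal (abs_nonneg (A k + ε • Ξ k ω).det),
        ENNReal.toReal_rpow] at this
    have hDtop : ∀ k, D k ω ≠ ∞ := fun k =>
      ENNReal.rpow_ne_top_of_ne_zero (by simpa using hdet k) ENNReal.ofReal_ne_top
    have h4 : (1 / (n : ℝ)) * ∑ k ∈ Finset.range n, (D k ω).toReal ≤ R := by
      have := ENNReal.toReal_mono ENNReal.coe_ne_top hn.le
      rw [ENNReal.toReal_mul, ENNReal.toReal_inv, ENNReal.toReal_natCast,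
        ENNReal.toReal_sum fun k _ => hDtop k] at this
      simpa using this
    have h5 := Finset.sum_le_sum fun k (_ : k ∈ Finset.range n) => h3 k
    rw [← Finset.mul_sum, Finset.sum_neg_distrib] at h5
    have h6 : 0 ≤ Real.log 3 := Real.log_nonneg (by norm_num)
    push_cast at h1
    calc (1 / (n : ℝ)) * (-(1 / 2) * Real.log (gapRatio j (P n)))
        ≤ (1 / (n : ℝ)) * (3 / 2 * (n * (Real.log 3 + Real.log 36))
            + 2 * ∑ k ∈ Finset.range n, (D k ω).toReal) := by
          gcongr
          nlinarith
      _ = 3 / 2 * (Real.log 3 + Real.log 36)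
            + 2 * ((1 / (n : ℝ)) * ∑ k ∈ Finset.range n, (D k ω).toReal) := by
          field_simp
      _ ≤ _ := by gcongr
  exact hle.trans_lt (EReal.coe_lt_top _)

omit [IsProbabilityMeasure μ] in
/-- By the Borel-Cantelli argument, a sequence of random variables whose means decay like `σ ^ n` is almost
surely eventually smaller than `τ ^ n` for every `τ > σ`. -/
lemma ae_eventually_le_pow_of_lintegral_le {f : ℕ → Ω → ℝ≥0∞} (mf : ∀ n, Measurable (f n)) {C : ℝ≥0∞}
    (hC : C ≠ ∞) {σ τ : ℝ} (hσ : 0 < σ) (hτ : σ < τ)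
    (hf : ∀ n, ∫⁻ ω, f n ω ∂μ ≤ C * ENNReal.ofReal σ ^ n) :
    ∀ᵐ ω ∂μ, ∀ᶠ n in atTop, f n ω ≤ ENNReal.ofReal τ ^ n := by
  have hτ0 := hσ.trans hτ
  set q : ℝ≥0∞ := ENNReal.ofReal (σ / τ) with hq
  have hq1 : q < 1 := by
    rw [hq, ENNReal.ofReal_lt_one, div_lt_one hτ0]
    exact hτ
  have hτne : ∀ n, (ENNReal.ofReal τ ^ n) ≠ 0 := fun n => pow_ne_zero _ (by simpa using hτ0)
  have hτtop : ∀ n, (ENNReal.ofReal τ ^ n) ≠ ∞ := fun n => by finiteness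
  have hsum : ∫⁻ ω, ∑' n, f n ω * (ENNReal.ofReal τ ^ n)⁻¹ ∂μ ≠ ∞ := by
    rw [lintegral_tsum fun n => ((mf n).mul_const _).aemeasurable]
    refine ne_top_of_le_ne_top (b := ∑' n, C * q ^ n) ?_ ?_
    · rw [ENNReal.tsum_mul_left, ENNReal.tsum_geometric]
      exact ENNReal.mul_ne_top hC (ENNReal.inv_ne_top.2 (tsub_pos_of_lt hq1).ne')
    · refine ENNReal.tsum_le_tsum fun n => ?_
      rw [lintegral_mul_const _ (mf n), hq, ENNReal.ofReal_div_of_pos hτ0, div_eq_mul_inv, mul_pow,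
        ENNReal.inv_pow, ← mul_assoc]
      gcongr
      exact hf n
  have hm : Measurable fun ω => ∑' n, f n ω * (ENNReal.ofReal τ ^ n)⁻¹ :=
    Measurable.tsum fun n => (mf n).mul_const _
  filter_upwards [ae_lt_top hm hsum] with ω hω
  have h0 := ENNReal.tendsto_atTop_zero_of_tsum_ne_top hω.ne
  filter_upwards [h0.eventually_le_const (zero_lt_one)] with n hn
  rwa [← div_eq_mul_inv, ENNReal.div_le_iff (hτne n) (hτtop n), one_mul] at hn

/-- The exponential decay of the mean of `√(gapRatio j P_n)` gives an almost sure lower bound for the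
growth rate of the gap. -/
lemma IsUniformNoise.ae_le_gapRate (h : IsUniformNoise μ Ξ) (hA : ∀ n i j, |A n i j| ≤ 1)
    (hε : 0 < ε) (hε1 : ε < 1) {N : ℕ} (hN : 9 / ε ≤ N) {τ : ℝ} (hσ : 0 < contractionRate N)
    (hτ : contractionRate N < τ) (j : Fin 2) :
    ∀ᵐ ω ∂μ, ((-Real.log τ : ℝ) : EReal) ≤ gapRate j (perturbedProduct ε A (fun k => Ξ k ω)) := by
  have hint := lintegral_sqrt_frobSq_div_le h (shearsFrames_exteriorAction j) (exteriorAction_one j)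
    hA hε hε1 hN
  have mf : ∀ n, Measurable fun ω => ENNReal.ofReal
      (√(frobSq (cofactorMatrix (exteriorAction j (perturbedProduct ε A (fun k => Ξ k ω) n))))
        / frobSq (exteriorAction j (perturbedProduct ε A (fun k => Ξ k ω) n))) := by
    intro n
    have hc := (shearsFrames_exteriorAction j).continuous
    have hc' := shearsFrames_cofactorMatrix.continuous
    have m1 : Measurable fun M : Matrix (Fin 3) (Fin 3) ℝ =>
        ENNReal.ofReal (√(frobSq (cofactorMatrix M)) / frobSq M) :=
      ENNReal.measurable_ofReal.comp ((continuous_frobSq.comp hc').sqrt.measurable.div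
        continuous_frobSq.measurable)
    exact m1.comp (hc.measurable.comp (measurable_perturbedProduct h ε A n))
  filter_upwards [ae_eventually_le_pow_of_lintegral_le mf (by norm_num) hσ hτ hint,
    h.ae_det_ne_zero A hε] with ω hω hdet
  refine le_liminf_of_le (by isBoundedDefault) ?_
  filter_upwards [hω, eventually_gt_atTop 0] with n hn hn0
  have hPn := det_perturbedProduct_ne_zero (X := fun k => Ξ k ω) hdet n
  set P := perturbedProduct ε A (fun k => Ξ k ω) n
  have hg := (gapRatio_bounds hPn j).1
  have hτ0 := hσ.trans hτ
  have e1 : √(gapRatio j P) = √(frobSq (cofactorMatrix (exteriorAction j P))) / frobSq (exteriorAction j P) := by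
    rw [gapRatio, areaRatio, Real.sqrt_div (frobSq_nonneg _), Real.sqrt_sq (frobSq_nonneg _)]
  rw [← e1, ← ENNReal.ofReal_pow hτ0.le, ENNReal.ofReal_le_ofReal_iff (by positivity)] at hn
  have h2 := Real.log_le_log (Real.sqrt_pos.2 hg) hn
  rw [Real.log_sqrt hg.le, Real.log_pow] at h2
  rw [EReal.coe_le_coe_iff, one_div, inv_mul_eq_div, le_div_iff₀ (by exact_mod_cast hn0)]
  linarith

end

/-! ### The zero-one law and the theorem -/

/-- Kolmogorov's zero-one law for extended real functions: if `L` agrees almost surely with functions `Z m`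
of the tail of the sequence from time `m` on, for every `m`, then it is almost surely constant. -/
lemma exists_ae_eq_const_of_tail {Ω : Type*} [mΩ : MeasurableSpace Ω] {μ : Measure Ω} [IsProbabilityMeasure μ]
    {s : ℕ → MeasurableSpace Ω} (hs : ∀ n, s n ≤ mΩ) (hind : iIndep s μ) {L : Ω → EReal}
    {Z : ℕ → Ω → EReal} (hZ : ∀ m, Measurable[⨆ i, ⨆ (_ : i ≥ m), s i] (Z m))
    (hL : ∀ᵐ ω ∂μ, ∀ m, Z m ω = L ω) : ∃ e : EReal, ∀ᵐ ω ∂μ, L ω = e := by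
  set Y : Ω → EReal := fun ω => limsup (fun m => Z m ω) atTop with hY
  have hYL : Y =ᵐ[μ] L := by
    filter_upwards [hL] with ω hω
    simp [hY, hω]
  have mY : ∀ U : Set EReal, MeasurableSet U → MeasurableSet[limsup s atTop] (Y ⁻¹' U) := by
    intro U hU
    rw [limsup_eq_iInf_iSup_of_nat, MeasurableSpace.measurableSet_iInf]
    intro n
    have h1 : Y = fun ω => limsup (fun m => Z (m + n) ω) atTop := by
      funext ω
      rw [hY, limsup_nat_add (fun m => Z m ω)]
    rw [h1]
    refine (@Measurable.limsup EReal Ω _ _ _ (⨆ i, ⨆ (_ : i ≥ n), s i) _ _ _ (fun m ω => Z (m + n) ω)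
      fun m => ?_) hU
    refine (hZ (m + n)).mono ?_ le_rfl
    exact iSup_mono fun i => iSup_const_mono fun hi => le_trans (Nat.le_add_left n m) hi
  have hle : limsup s atTop ≤ mΩ := by
    rw [limsup_eq_iInf_iSup_of_nat]
    exact (iInf_le _ 0).trans (iSup_le fun i => iSup_le fun _ => hs i)
  obtain ⟨e, he⟩ := exists_eventuallyEq_const_of_forall_separating (l := ae μ) (f := Y) MeasurableSet
    fun U hU => by
      have hm := hle _ (mY U hU)
      rcases measure_zero_or_one_of_measurableSet_limsup_atTop hs hind (mY U hU) with h0 | h1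
      · right
        exact measure_eq_zero_iff_ae_notMem.1 h0
      · left
        exact (prob_compl_eq_zero_iff hm).2 h1
  exact ⟨e, hYL.symm.trans he⟩

/-- The growth rate computed from the factors with index at least `m` only. The normalisation by
`n + m` instead of `n` makes it directly comparable with that of the full product. -/
noncomputable def tailRate (j : Fin 2) (ε : ℝ) (A X : ℕ → Matrix (Fin 3) (Fin 3) ℝ) (m : ℕ) : EReal :=
  liminf (fun n : ℕ => (((1 / ((n + m : ℕ) : ℝ)) * (-(1 / 2) * Real.log (gapRatio j
    (perturbedProduct ε (fun k => A (k + m)) (fun k => X (k + m)) n))) : ℝ) : EReal)) atTop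

lemma tailRate_eq_gapRate {ε : ℝ} {A X : ℕ → Matrix (Fin 3) (Fin 3) ℝ}
    (h : ∀ k, (A k + ε • X k).det ≠ 0) (j : Fin 2) (m : ℕ) :
    tailRate j ε A X m = gapRate j (perturbedProduct ε A X) := by
  obtain ⟨C, hC⟩ := exists_abs_log_areaRatio_mul_sub_le
    (det_exteriorAction_ne_zero (det_perturbedProduct_ne_zero h m) j)
  unfold gapRate
  rw [← liminf_nat_add _ m]
  refine liminf_coe_eq_of_tendsto_sub ?_
  have h0 := (tendsto_const_div_atTop_nhds_zero_nat C).comp (tendsto_add_atTop_nat m)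
  refine squeeze_zero_norm (fun n => ?_) h0
  have hn := hC _ (det_exteriorAction_ne_zero (det_perturbedProduct_ne_zero (fun k => h (k + m)) n) j)
  rw [← (shearsFrames_exteriorAction j).map_mul, ← perturbedProduct_add] at hn
  rw [Real.norm_eq_abs, ← mul_sub, abs_mul, abs_of_nonneg (by positivity), one_div, inv_mul_eq_div,
    Function.comp_apply]
  gcongr
  rw [← mul_sub, abs_mul, abs_sub_comm]
  have hh : |(-(1 / 2) : ℝ)| = 1 / 2 := by norm_num
  rw [hh]
  have := abs_nonneg (Real.log (gapRatio j (perturbedProduct ε A X (n + m)))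
    - Real.log (gapRatio j (perturbedProduct ε (fun k => A (k + m)) (fun k => X (k + m)) n)))
  unfold gapRatio at this ⊢
  linarith

lemma measurable_gapRatio (j : Fin 2) : Measurable (gapRatio j) := by
  have hc := (shearsFrames_exteriorAction j).continuous
  have hc' := shearsFrames_cofactorMatrix.continuous
  exact (continuous_frobSq.comp (hc'.comp hc)).measurable.div
    ((continuous_frobSq.comp hc).pow 2).measurable

lemma measurable_tailRate {Ω : Type*} [MeasurableSpace Ω] {X : ℕ → Ω → Matrix (Fin 3) (Fin 3) ℝ} {m : ℕ}
    (hX : ∀ k, m ≤ k → Measurable (X k)) (j : Fin 2) (ε : ℝ) (A : ℕ → Matrix (Fin 3) (Fin 3) ℝ) :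
    Measurable fun ω => tailRate j ε A (fun k => X k ω) m := by
  refine Measurable.liminf fun n => measurable_coe_real_ereal.comp ?_
  have mP : Measurable fun ω => perturbedProduct ε (fun k => A (k + m)) (fun k => X (k + m) ω) n := by
    obtain ⟨f, hf, hfX⟩ := exists_measurable_perturbedProduct ε (fun k => A (k + m)) n
    simp only [hfX]
    exact hf.comp (measurable_pi_lambda _ fun i => hX _ (Nat.le_add_left _ _))
  exact ((Real.measurable_log.comp ((measurable_gapRatio j).comp mP)).const_mul _).const_mul _

section

variable {Ω : Type*} [MeasurableSpace Ω] {μ : Measure Ω} [IsProbabilityMeasure μ]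
  {Ξ : ℕ → Ω → Matrix (Fin 3) (Fin 3) ℝ} {ε : ℝ}

/-- The growth rate of the gap does not depend on finitely many factors, hence is almost surely constant. -/
lemma IsUniformNoise.exists_ae_gapRate_eq (h : IsUniformNoise μ Ξ) (A : ℕ → Matrix (Fin 3) (Fin 3) ℝ)
    (hε : 0 < ε) (j : Fin 2) :
    ∃ e : EReal, ∀ᵐ ω ∂μ, gapRate j (perturbedProduct ε A (fun k => Ξ k ω)) = e := by
  refine exists_ae_eq_const_of_tail (s := fun n => MeasurableSpace.comap (Ξ n) inferInstance)
    (fun n => (h.measurable n).comap_le) h.iIndepFun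
    (Z := fun m ω => tailRate j ε A (fun k => Ξ k ω) m) (fun m => ?_) ?_
  · refine @measurable_tailRate Ω (⨆ i, ⨆ (_ : i ≥ m), MeasurableSpace.comap (Ξ i) inferInstance) Ξ m
      (fun k hk => ?_) j ε A
    exact Measurable.mono (comap_measurable (Ξ k))
      (le_iSup₂_of_le (f := fun i (_ : i ≥ m) => MeasurableSpace.comap (Ξ i) inferInstance) k hk le_rfl)
      le_rfl
  · filter_upwards [h.ae_det_ne_zero A hε] with ω hω m
    exact tailRate_eq_gapRate hω j m

end

lemma abs_entry_le_norm_toEuclideanCLM (A : Matrix (Fin 3) (Fin 3) ℝ) (i j : Fin 3) :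
    |A i j| ≤ ‖Matrix.toEuclideanCLM (n := Fin 3) (𝕜 := ℝ) A‖ := by
  set T := Matrix.toEuclideanCLM (n := Fin 3) (𝕜 := ℝ) A with hT
  have h1 : T (EuclideanSpace.single j 1) i = A i j := by
    rw [hT, Matrix.ofLp_toEuclideanCLM]
    simp
  calc |A i j| = ‖T (EuclideanSpace.single j 1) i‖ := by rw [h1, Real.norm_eq_abs]
    _ ≤ ‖T (EuclideanSpace.single j 1)‖ := PiLp.norm_apply_le _ _
    _ ≤ ‖T‖ * ‖EuclideanSpace.single j (1 : ℝ)‖ := T.le_opNorm _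
    _ = ‖T‖ := by simp

/-- With `N = ⌈9 / ε⌉₊ ≤ 10 / ε` the contraction rate has `1 - σ² ≥ ε² / 14745600`, which exceeds twice
the exponent `ε² / 10 ^ 8`. -/
lemma contractionRate_lt_exp {ε : ℝ} (hε : 0 < ε) (hε1 : ε < 1) :
    0 < contractionRate ⌈9 / ε⌉₊ ∧ contractionRate ⌈9 / ε⌉₊ < Real.exp (-(ε ^ 2 / 10 ^ 8)) := by
  have hN1 : 9 / ε ≤ (⌈9 / ε⌉₊ : ℝ) := Nat.le_ceil _
  have hN2 : (⌈9 / ε⌉₊ : ℝ) < 9 / ε + 1 := Nat.ceil_lt_add_one (by positivity)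
  set N : ℝ := (⌈9 / ε⌉₊ : ℝ)
  have h9 : 9 < 9 / ε := by rw [lt_div_iff₀ hε]; linarith
  have hN3 : N * ε ≤ 10 := by
    have : N * ε ≤ (9 / ε + 1) * ε := by gcongr
    have e : (9 / ε + 1) * ε = 9 + ε := by field_simp
    linarith
  have hN : 9 < N := h9.trans_le hN1
  have hx1 : 1 / (147456 * N ^ 2) < 1 := by
    rw [div_lt_one (by positivity)]
    nlinarith
  have hx2 : 2 * (ε ^ 2 / 10 ^ 8) < 1 / (147456 * N ^ 2) := by
    rw [lt_div_iff₀ (by positivity)]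
    have : (N * ε) ^ 2 ≤ 10 ^ 2 := by gcongr
    nlinarith
  refine ⟨Real.sqrt_pos.2 (by linarith), ?_⟩
  rw [contractionRate, Real.sqrt_lt' (Real.exp_pos _), ← Real.exp_nat_mul]
  have := Real.add_one_le_exp (((2 : ℕ) : ℝ) * -(ε ^ 2 / 10 ^ 8))
  push_cast at this ⊢
  linarith

lemma eventually_exp_lt : ∀ᶠ ε : ℝ in 𝓝[>] 0, Real.exp (-1 / ε ^ 867) < ε ^ 2 / 10 ^ 8 := by
  filter_upwards [Ioo_mem_nhdsGT (show (0 : ℝ) < 1 / 10 ^ 8 by norm_num)] with ε hε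
  obtain ⟨h0, h1⟩ := hε
  have hp : 0 < ε ^ 867 := pow_pos h0 _
  have h2 : (ε ^ 867)⁻¹ < Real.exp (ε ^ 867)⁻¹ := by
    have := Real.add_one_le_exp (ε ^ 867)⁻¹
    linarith
  have h3 : ε ^ 867 ≤ ε ^ 3 := pow_le_pow_of_le_one h0.le (h1.le.trans (by norm_num)) (by norm_num)
  calc Real.exp (-1 / ε ^ 867) = (Real.exp (ε ^ 867)⁻¹)⁻¹ := by
        rw [neg_div, one_div, Real.exp_neg]
    _ < ((ε ^ 867)⁻¹)⁻¹ := inv_strictAnti₀ (inv_pos.2 hp) h2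
    _ = ε ^ 867 := inv_inv _
    _ ≤ ε ^ 3 := h3
    _ = ε ^ 2 * ε := by ring
    _ ≤ ε ^ 2 * (1 / 10 ^ 8) := by gcongr
    _ = ε ^ 2 / 10 ^ 8 := by ring

theorem theoremB :
    ∃ c₃ : ℝ → ℝ,
      (∀ ε : ℝ, 0 < ε → ε < 1 →
        0 < c₃ ε ∧
        ∀ A : ℕ → Matrix (Fin 3) (Fin 3) ℝ,
          (∀ n : ℕ, ‖Matrix.toEuclideanCLM (n := Fin 3) (𝕜 := ℝ) (A n)‖ ≤ 1) →
          ∀ (Ω : Type*) [MeasurableSpace Ω] (μ : Measure Ω) [IsProbabilityMeasure μ]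
            (Ξ : ℕ → Ω → Matrix (Fin 3) (Fin 3) ℝ), IsUniformNoise μ Ξ →
          ∀ j : Fin 2, ∃ l : ℝ, c₃ ε ≤ l ∧
            ∀ᵐ ω ∂μ, gapGrowthRate (perturbedProduct ε A (fun n => Ξ n ω)) j = (l : EReal)) ∧
      (∀ᶠ ε : ℝ in 𝓝[>] 0, Real.exp (-1 / ε ^ 867) < c₃ ε) := by
  refine ⟨fun ε => ε ^ 2 / 10 ^ 8, fun ε hε hε1 => ⟨by positivity, ?_⟩, eventually_exp_lt⟩
  intro A hA' Ω _ μ _ Ξ h j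
  have hA : ∀ n i j, |A n i j| ≤ 1 := fun n i j =>
    (abs_entry_le_norm_toEuclideanCLM (A n) i j).trans (hA' n)
  obtain ⟨e, he⟩ := h.exists_ae_gapRate_eq A hε j
  obtain ⟨hσ, hτ⟩ := contractionRate_lt_exp hε hε1
  have hlow := h.ae_le_gapRate hA hε hε1 (Nat.le_ceil _) hσ hτ j
  have hup := h.ae_gapRate_lt_top hA hε hε1 j
  rw [Real.log_exp, neg_neg] at hlow
  obtain ⟨ω, hω, hω1, hω2⟩ := (he.and (hlow.and hup)).exists
  rw [hω] at hω1 hω2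
  have hbot : e ≠ ⊥ := ((EReal.bot_lt_coe _).trans_le hω1).ne'
  lift e to ℝ using ⟨hω2.ne, hbot⟩
  refine ⟨e, EReal.coe_le_coe_iff.1 hω1, ?_⟩
  filter_upwards [he, h.ae_det_ne_zero A hε] with ω hω hdet
  rw [gapGrowthRate_eq_gapRate (det_perturbedProduct_ne_zero hdet) j, hω]
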